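/- **Setting.** A point $p$ *dominates* $q$ if both coordinates of $p$ are at least those of $q$; $p$ dominates a rectangle if it dominates its top right vertex. For a finite family $P$ of points, the *Pareto front* is the boundary of the set of points dominated by a point of $P$; it is a staircase whose vertical edges have a point of $P$ as top vertex and whose horizontal edges have a point of $P$ as right vertex (the two unbounded end edges included). Its combinatorial structure is the left-to-right sequence of the indices of the points of $P$ that no other point of $P$ dominates. Let $\mathcal R^{\circ}$ be a finite family of pairwise disjoint closed axis-aligned rectangles (single points allowed) in general position: vertices of different rectangles share no coordinate. A region is *negative* (*positive*) if for no (every) choice of one point in each region its point is on the Pareto front, and *potential* otherwise; the *guaranteed boundary* is the Pareto front of the bottom left vertices. Truncation removes the negative regions; each potential region whose bottom left vertex is below the guaranteed boundary is *flagged* and replaced by its part above that boundary; the remaining regions are indexed $R_1,\dots,R_n$ from top left to bottom right by their bottom left vertices. The result $\mathcal R=(R_1,\dots,R_n)$ is called a *truncated set*. A point family $P=(p_1,\dots,p_n)$ *respects* $\mathcal R$ if each $p_i$ lies in the rectangle of $\mathcal R^{\circ}$ from which $R_i$ stems (so the point of a flagged region may lie in the part that was cut off) and $p_i$ shares no coordinate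 with $p_j$ or with a vertex of the original rectangle of $R_j$, for $j\ne i$. $R_i$ has a vertical arrow to $R_j$ if $i<j$ and some vertical segment, not merely grazing the side of one of the two regions, connects $R_i$ and $R_j$ without meeting another region; it has a horizontal arrow to $R_j$ if $j<i$ and some horizontal segment does so. A *sink* is a region without outgoing arrows. Let $V_i(P)$ consist of $R_i$ and all $R_j$ that receive a vertical arrow from $R_i$ and are dominated by some $p_k$ with $k\le i$, and let $H_i(P)$ consist of $R_i$ and all $R_j$ that receive a horizontal arrow from $R_i$ and are dominated by some $p_k$ with $k\ge i$. Let $\tilde{\mathcal R}(P)$ be the set of those $R_i$ that meet the Pareto front of $P$ and in addition are flagged, or meet an edge of the Pareto front that has a point $p_j$, $j\neq i$, as an endpoint, or are not a sink. For a retrieval cost $C\ge 0$ put $$\mathrm{CP}(\mathcal R,P)=\sum_{R_i\in\tilde{\mathcal R}(P)}\bigl(C+\log_2|V_i(P)|+\log_2|H_i(P)|\bigr).$$ An algorithm with auxiliary data structure $(A,\Xi)$ is a finite real RAM program (word memory and real memory, arithmetic on words and on reals, comparisons, no rounding from reals to words) with arbitrary prestored memory contents $\Xi$, both of which may depend on $\mathcal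 R$. It can retrieve the point $p_i$ for a given index $i$ at cost $C$; every other instruction, including the final halt, costs $1$. For every $P$ that respects $\mathcal R$ it has to halt with a representation of the combinatorial Pareto front of $P$ by pointers to (retrieved or unretrieved) points in its word memory. The *uncertainty-region lower bound* of $\mathcal R$ is $$\mathrm{LB}(\mathcal R)=\min_{(A,\Xi)}\ \max_{P\text{ respects }\mathcal R}\mathrm{Runtime}(A,\Xi,\mathcal R,P).$$ **Theorem.** Let $\mathcal R$ be a truncated set and let $P$ be any point family that respects $\mathcal R$. Then $$\mathrm{CP}(\mathcal R,P)<3\cdot \mathrm{LB}(\mathcal R).$$ Moreover, $$\sum_{R_i\in\tilde{\mathcal R}(P)}\bigl(\log_2|V_i(P)|+\log_2|H_i(P)|\bigr)\le 2\log_2 L(\mathcal R),$$ where $L(\mathcal R)$ is the number of combinatorially distinct Pareto fronts of point families that respect $\mathcal R$. -/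

import Mathlib

open scoped NNReal ENNReal

noncomputable section

namespace ParetoPre

/-! ### Rectangles, points and Pareto fronts

Points of the plane are elements of `ℝ × ℝ`; `q ≤ p` in the product order means that `p`
(Pareto) dominates `q`. -/

/-- A closed axis-aligned rectangle with bottom left vertex `bl` and top right vertex `tr`;
a single point counts as a degenerate rectangle. -/
structure Rect where
  bl : ℝ × ℝ
  tr : ℝ × ℝ
  shape : (bl.1 < tr.1 ∧ bl.2 < tr.2) ∨ bl = tr

/-- The points of a closed rectangle. -/
def Rect.toSet (R : Rect) : Set (ℝ × ℝ) := Set.Icc R.bl R.tr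

/-- The relative interior of the projection of a rectangle to the `x`-axis. -/
def Rect.xCore (R : Rect) : Set ℝ :=
  {x | (R.bl.1 < x ∧ x < R.tr.1) ∨ (x = R.bl.1 ∧ x = R.tr.1)}

/-- The relative interior of the projection of a rectangle to the `y`-axis. -/
def Rect.yCore (R : Rect) : Set ℝ :=
  {y | (R.bl.2 < y ∧ y < R.tr.2) ∨ (y = R.bl.2 ∧ y = R.tr.2)}

section Families

variable {ι : Type}

/-- The set of points of the plane that are dominated by a point of `P`. -/
def dominated (P : ι → ℝ × ℝ) : Set (ℝ × ℝ) := {q | ∃ i, q ≤ P i}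

/-- The Pareto front of `P` as a curve (a staircase): the boundary of the dominated set. -/
def front (P : ι → ℝ × ℝ) : Set (ℝ × ℝ) := frontier (dominated P)

/-- The point `P i` is part of the Pareto front: no other point of `P` dominates it. -/
def OnFront (P : ι → ℝ × ℝ) (i : ι) : Prop := ∀ j, j ≠ i → ¬ P i ≤ P j

/-- The vertical edge of the Pareto front with top vertex `P j` (for `P j` on the front). -/
def vertEdge (P : ι → ℝ × ℝ) (j : ι) : Set (ℝ × ℝ) :=
  {q | q ∈ front P ∧ q.1 = (P j).1 ∧ q.2 ≤ (P j).2}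

/-- The horizontal edge of the Pareto front with right vertex `P j` (for `P j` on the front). -/
def horEdge (P : ι → ℝ × ℝ) (j : ι) : Set (ℝ × ℝ) :=
  {q | q ∈ front P ∧ q.2 = (P j).2 ∧ q.1 ≤ (P j).1}

/-- The combinatorial Pareto front: `l` lists the indices of the points on the Pareto front
of `P`, from left to right. -/
def IsFrontSeq (P : ι → ℝ × ℝ) (l : List ι) : Prop :=
  l.Pairwise (fun i j => (P i).1 < (P j).1) ∧ ∀ i, i ∈ l ↔ OnFront P i

/-- Vertices of different regions share no coordinate. -/
def RegionsGeneral (R : ι → Rect) : Prop :=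
  ∀ i j, i ≠ j → ∀ u ∈ ({(R i).bl, (R i).tr} : Set (ℝ × ℝ)),
    ∀ v ∈ ({(R j).bl, (R j).tr} : Set (ℝ × ℝ)), u.1 ≠ v.1 ∧ u.2 ≠ v.2

/-- A point shares no coordinate with another point or with a vertex of the region of
another point. -/
def PointsGeneral (R : ι → Rect) (P : ι → ℝ × ℝ) : Prop :=
  ∀ i j, i ≠ j → ∀ v ∈ ({P j, (R j).bl, (R j).tr} : Set (ℝ × ℝ)),
    (P i).1 ≠ v.1 ∧ (P i).2 ≠ v.2

/-- `P` respects the regions `R`: each point lies in its region (and the points are in general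
position, which is assumed throughout). -/
def Respects (R : ι → Rect) (P : ι → ℝ × ℝ) : Prop :=
  (∀ i, P i ∈ (R i).toSet) ∧ PointsGeneral R P

/-- `R i` is negative: for every choice of `P`, its point is not on the Pareto front. -/
def IsNegative (R : ι → Rect) (i : ι) : Prop := ∀ P, Respects R P → ¬ OnFront P i

/-- `R i` is positive: for every choice of `P`, its point is on the Pareto front. -/
def IsPositive (R : ι → Rect) (i : ι) : Prop := ∀ P, Respects R P → OnFront P i

/-- `R i` is potential: neither negative nor positive. -/
def IsPotential (R : ι → Rect) (i : ι) : Prop := ¬ IsNegative R i ∧ ¬ IsPositive R i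

/-- The points strictly below the guaranteed boundary, which is the Pareto front of the
bottom left vertices of the regions. -/
def belowBoundary (R : ι → Rect) : Set (ℝ × ℝ) := interior (dominated fun i => (R i).bl)

end Families

/-! ### Truncated sets -/

/-- A truncated set of `n` regions: the result of truncating an original set `orig` of pairwise
disjoint rectangles in general position. Negative regions are removed, each potential region
whose bottom left vertex is below the guaranteed boundary is flagged and replaced by its part
above that boundary, and the remaining regions are indexed from top left to bottom right by
their bottom left vertices. `src k` is the original region from which the `k`-th region
stems. -/
structure TruncatedSet (n : ℕ) where
  m : ℕ
  orig : Fin m → Rect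
  disjoint : ∀ i j, i ≠ j → Disjoint (orig i).toSet (orig j).toSet
  general : RegionsGeneral orig
  src : Fin n → Fin m
  src_injective : Function.Injective src
  src_range : ∀ i, i ∈ Set.range src ↔ ¬ IsNegative orig i
  flagged : Fin n → Prop
  flagged_iff : ∀ k, flagged k ↔
    IsPotential orig (src k) ∧ (orig (src k)).bl ∈ belowBoundary orig
  region : Fin n → Rect
  region_of_flagged : ∀ k, flagged k →
    (region k).toSet = (orig (src k)).toSet \ belowBoundary orig
  region_of_not_flagged : ∀ k, ¬ flagged k → region k = orig (src k)
  sorted : ∀ k l, k < l → (region k).bl.1 < (region l).bl.1 ∨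
    ((region k).bl.1 = (region l).bl.1 ∧ (region l).bl.2 < (region k).bl.2)

namespace TruncatedSet

variable {n : ℕ} (R : TruncatedSet n)

/-- `P` respects `R`: every `P k` lies in the uncertainty region from which the `k`-th region
stems. So the point of a flagged region may also lie in the part cut off by the truncation;
for a region that is not flagged nothing was cut off. -/
def Respects (P : Fin n → ℝ × ℝ) : Prop := ParetoPre.Respects (fun k => R.orig (R.src k)) P

/-- A vertical segment connects regions `i` and `j` without meeting any other region. (A segment
that merely grazes the side of a region does not count.) -/
def VertVisible (i j : Fin n) : Prop :=
  ∃ x y₁ y₂, x ∈ (R.region i).xCore ∧ x ∈ (R.region j).xCore ∧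
    (x, y₁) ∈ (R.region i).toSet ∧ (x, y₂) ∈ (R.region j).toSet ∧
    ∀ k, k ≠ i → k ≠ j → ∀ y ∈ Set.uIcc y₁ y₂, (x, y) ∉ (R.region k).toSet

/-- A horizontal segment connects regions `i` and `j` without meeting any other region. -/
def HorVisible (i j : Fin n) : Prop :=
  ∃ y x₁ x₂, y ∈ (R.region i).yCore ∧ y ∈ (R.region j).yCore ∧
    (x₁, y) ∈ (R.region i).toSet ∧ (x₂, y) ∈ (R.region j).toSet ∧
    ∀ k, k ≠ i → k ≠ j → ∀ x ∈ Set.uIcc x₁ x₂, (x, y) ∉ (R.region k).toSet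

/-- Vertical arrows of the dependency graph lead to succeeding, vertically visible regions. -/
def VertArrow (i j : Fin n) : Prop := i < j ∧ R.VertVisible i j

/-- Horizontal arrows of the dependency graph lead to preceding, horizontally visible
regions. -/
def HorArrow (i j : Fin n) : Prop := j < i ∧ R.HorVisible i j

/-- Sinks of the dependency graph. -/
def IsSink (i : Fin n) : Prop := ∀ j, ¬ R.VertArrow i j ∧ ¬ R.HorArrow i j

/-- The set `V_i`: region `i` and the succeeding regions vertically visible from it. -/
def V (i : Fin n) : Set (Fin n) := {j | j = i ∨ R.VertArrow i j}

/-- The set `H_i`: region `i` and the preceding regions horizontally visible from it. -/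
def H (i : Fin n) : Set (Fin n) := {j | j = i ∨ R.HorArrow i j}

/-- The set `V_i(P)`: region `i` and the regions of `V_i` that are dominated by a point with
index at most `i`. -/
def VP (P : Fin n → ℝ × ℝ) (i : Fin n) : Set (Fin n) :=
  {j | j = i ∨ (j ∈ R.V i ∧ ∃ l ≤ i, (R.region j).tr ≤ P l)}

/-- The set `H_i(P)`: region `i` and the regions of `H_i` that are dominated by a point with
index at least `i`. -/
def HP (P : Fin n → ℝ × ℝ) (i : Fin n) : Set (Fin n) :=
  {j | j = i ∨ (j ∈ R.H i ∧ ∃ l, i ≤ l ∧ (R.region j).tr ≤ P l)}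

/-- The set `R̃(P)` of geometrically interesting regions: those which the Pareto front of `P`
intersects and which are flagged, or intersect an edge of the Pareto front that has another
point as an endpoint, or are not a sink of the dependency graph. -/
def Interesting (P : Fin n → ℝ × ℝ) (i : Fin n) : Prop :=
  ((R.region i).toSet ∩ front P).Nonempty ∧
    (R.flagged i ∨
      (∃ j, j ≠ i ∧ OnFront P j ∧
        ((R.region i).toSet ∩ (vertEdge P j ∪ horEdge P j)).Nonempty) ∨
      ¬ R.IsSink i)

open Classical in
/-- The set `R̃(P)` as a finset. -/
def interesting (P : Fin n → ℝ × ℝ) : Finset (Fin n) :=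
  Finset.univ.filter fun i => R.Interesting P i

/-- The Pareto cost function `CP(R, P)` for the retrieval cost `C`. -/
def paretoCost (C : ℝ≥0) (P : Fin n → ℝ × ℝ) : ℝ :=
  ∑ i ∈ R.interesting P,
    ((C : ℝ) + Real.logb 2 ((R.VP P i).ncard : ℝ) + Real.logb 2 ((R.HP P i).ncard : ℝ))

/-- `L(R)`: the number of combinatorially distinct Pareto fronts of point sets that
respect `R`. -/
def numFronts : ℕ := {l : List (Fin n) | ∃ P, R.Respects P ∧ IsFrontSeq P l}.ncard

end TruncatedSet

/-! ### Real RAM with retrievals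

The machine has a word memory and a separate real memory. Real values influence the word memory
and the control flow only through comparisons; there is no rounding from reals to words. -/

/-- Arithmetic and Boolean operations on words. -/
inductive WordOp
  | add | sub | mul | div | and | or | xor

/-- The meaning of the operations on words. -/
def WordOp.eval : WordOp → ℕ → ℕ → ℕ
  | add, a, b => a + b
  | sub, a, b => a - b
  | mul, a, b => a * b
  | div, a, b => a / b
  | and, a, b => a &&& b
  | or, a, b => a ||| b
  | xor, a, b => a ^^^ b

/-- Arithmetic operations on reals. -/
inductive RealOp
  | add | sub | mul | div

/-- The meaning of the operations on reals. -/
def RealOp.eval : RealOp → ℝ → ℝ → ℝ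
  | add, a, b => a + b
  | sub, a, b => a - b
  | mul, a, b => a * b
  | div, a, b => a / b

/-- The instructions; `W` is the word memory and `X` the real memory. -/
inductive Instr
  /-- `W[a] := c` -/
  | wordConst (a c : ℕ)
  /-- `W[a] := W[b]` -/
  | wordCopy (a b : ℕ)
  /-- `W[a] := W[W[b]]` -/
  | wordLoad (a b : ℕ)
  /-- `W[W[a]] := W[b]` -/
  | wordStore (a b : ℕ)
  /-- `W[a] := W[b] o W[c]` -/
  | wordOp (o : WordOp) (a b c : ℕ)
  /-- `X[a] := W[b]` -/
  | cast (a b : ℕ)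
  /-- `X[a] := X[b]` -/
  | realCopy (a b : ℕ)
  /-- `X[a] := X[W[b]]` -/
  | realLoad (a b : ℕ)
  /-- `X[W[a]] := X[b]` -/
  | realStore (a b : ℕ)
  /-- `X[a] := X[b] o X[c]` -/
  | realOp (o : RealOp) (a b c : ℕ)
  /-- `X[a] := √X[b]` -/
  | realSqrt (a b : ℕ)
  /-- `if W[a] = W[b] goto l` -/
  | ifWordEq (a b l : ℕ)
  /-- `if W[a] < W[b] goto l` -/
  | ifWordLt (a b l : ℕ)
  /-- `if X[a] = 0 goto l` -/
  | ifRealZero (a l : ℕ)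
  /-- `if X[a] > 0 goto l` -/
  | ifRealPos (a l : ℕ)
  /-- `goto l` -/
  | goto (l : ℕ)
  /-- Retrieve the point with index `W[b]` and store its coordinates in `X[a]` and `X[a+1]`. -/
  | retrieve (a b : ℕ)
  /-- Stop. -/
  | halt

/-- A configuration: program counter, word memory, real memory. -/
structure Config where
  pc : ℕ
  word : ℕ → ℕ
  real : ℕ → ℝ

/-- An algorithm together with its auxiliary data structure, for inputs with `n` points: a finite
program, arbitrary prestored contents of both memories, and the way in which the Pareto front
(given by pointers to retrieved or unretrieved points, that is, by indices) is represented in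
the word memory at a `halt` instruction. -/
structure Algorithm (n : ℕ) where
  prog : List Instr
  word₀ : ℕ → ℕ
  real₀ : ℕ → ℝ
  represents : ℕ → (ℕ → ℕ) → List (Fin n)

open Classical in
/-- The effect of one instruction. -/
def exec {n : ℕ} (P : Fin n → ℝ × ℝ) (I : Instr) (s : Config) : Config :=
  match I with
  | .wordConst a c => ⟨s.pc + 1, Function.update s.word a c, s.real⟩
  | .wordCopy a b => ⟨s.pc + 1, Function.update s.word a (s.word b), s.real⟩
  | .wordLoad a b => ⟨s.pc + 1, Function.update s.word a (s.word (s.word b)), s.real⟩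
  | .wordStore a b => ⟨s.pc + 1, Function.update s.word (s.word a) (s.word b), s.real⟩
  | .wordOp o a b c =>
      ⟨s.pc + 1, Function.update s.word a (o.eval (s.word b) (s.word c)), s.real⟩
  | .cast a b => ⟨s.pc + 1, s.word, Function.update s.real a (s.word b : ℝ)⟩
  | .realCopy a b => ⟨s.pc + 1, s.word, Function.update s.real a (s.real b)⟩
  | .realLoad a b => ⟨s.pc + 1, s.word, Function.update s.real a (s.real (s.word b))⟩
  | .realStore a b => ⟨s.pc + 1, s.word, Function.update s.real (s.word a) (s.real b)⟩
  | .realOp o a b c =>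
      ⟨s.pc + 1, s.word, Function.update s.real a (o.eval (s.real b) (s.real c))⟩
  | .realSqrt a b => ⟨s.pc + 1, s.word, Function.update s.real a (Real.sqrt (s.real b))⟩
  | .ifWordEq a b l => ⟨if s.word a = s.word b then l else s.pc + 1, s.word, s.real⟩
  | .ifWordLt a b l => ⟨if s.word a < s.word b then l else s.pc + 1, s.word, s.real⟩
  | .ifRealZero a l => ⟨if s.real a = 0 then l else s.pc + 1, s.word, s.real⟩
  | .ifRealPos a l => ⟨if 0 < s.real a then l else s.pc + 1, s.word, s.real⟩
  | .goto l => ⟨l, s.word, s.real⟩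
  | .retrieve a b =>
      let p : ℝ × ℝ := if h : s.word b < n then P ⟨s.word b, h⟩ else 0
      ⟨s.pc + 1, s.word, Function.update (Function.update s.real a p.1) (a + 1) p.2⟩
  | .halt => s

/-- A retrieval costs `C`, every other instruction (also `halt`) costs `1`. -/
def Instr.cost (C : ℝ≥0) : Instr → ℝ≥0∞
  | .retrieve _ _ => (C : ℝ≥0∞)
  | _ => 1

namespace Algorithm

variable {n : ℕ} (A : Algorithm n)

/-- One step; a machine whose program counter has left the program is stuck. -/
def step (P : Fin n → ℝ × ℝ) (s : Config) : Config :=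
  match A.prog[s.pc]? with
  | some I => exec P I s
  | none => s

/-- The configuration after `t` steps. -/
def run (P : Fin n → ℝ × ℝ) : ℕ → Config
  | 0 => ⟨0, A.word₀, A.real₀⟩
  | t + 1 => A.step P (run P t)

/-- The instruction that is due after `t` steps. -/
def instrAt (P : Fin n → ℝ × ℝ) (t : ℕ) : Option Instr := A.prog[(A.run P t).pc]?

/-- After `t` steps the machine is at a `halt` instruction. -/
def HaltsAt (P : Fin n → ℝ × ℝ) (t : ℕ) : Prop := A.instrAt P t = some Instr.halt

/-- The cost of the instructions executed up to and including the one due after `t` steps. -/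
def costUpTo (C : ℝ≥0) (P : Fin n → ℝ × ℝ) (t : ℕ) : ℝ≥0∞ :=
  ∑ s ∈ Finset.range (t + 1), ((A.instrAt P s).elim 0 (Instr.cost C))

/-- The running time on `P`: the cost of the instructions executed until the machine halts,
and `⊤` if it never halts. -/
def runtime (C : ℝ≥0) (P : Fin n → ℝ × ℝ) : ℝ≥0∞ :=
  ⨅ (t : ℕ) (_ : A.HaltsAt P t), A.costUpTo C P t

/-- `A` constructs the Pareto front of every point set that respects `R`. -/
def Solves (R : TruncatedSet n) : Prop :=
  ∀ P, R.Respects P → ∃ t, A.HaltsAt P t ∧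
    IsFrontSeq P (A.represents (A.run P t).pc (A.run P t).word)

end Algorithm

/-- The uncertainty-region lower bound of `R`: the minimum, over all algorithms with auxiliary
data structure that construct the Pareto front, of the maximal running time over all point sets
that respect `R`. -/
def uncertaintyRegionLowerBound (C : ℝ≥0) {n : ℕ} (R : TruncatedSet n) : ℝ≥0∞ :=
  ⨅ (A : Algorithm n) (_ : A.Solves R), ⨆ (P : Fin n → ℝ × ℝ) (_ : R.Respects P), A.runtime C P

end ParetoPre

end

/-!
The lower bounds come from families of point sets (`TruncatedSet.HasFamily`) which respect the
regions and have `N` different combinatorial Pareto fronts, and in each of which the points with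
index in `K` are undetermined: the front depends on their positions even if all other points are
known. A correct algorithm retrieves every undetermined point. Real values influence its output only
through the outcomes of comparisons, so following the more frequent outcome leads to a member of the
family on which it makes at least `log₂ N` comparisons. Together with the final halt this gives
`C * |K| + log₂ N + 1 ≤ LB` (`HasFamily.le_lowerBound`), and of course `N ≤ L` (`le_numFronts`).

Three families suffice. Let `S` be the set of interesting regions. None of them is dominated by the
point of another region, whereas the regions counted by `V_i(P)`, other than `i` itself, are
dominated. Hence a region of `S` after `i` would hide from `i` every region of `V_i(P)` that comes
after it (`lt_of_mem_VP`), and the sets `V_i(P)`, `i ∈ S`, occupy separate ranges of indices.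
Place every point near the bottom left vertex of its region; this gives an antichain. Now every
`i ∈ S` may independently move its point to the right, until it dominates the points of an initial
segment of `V_i(P)`. So there is a family of `∏ |V_i(P)|` point sets with different fronts
(`hasFamily_vert`), and by reflection in the diagonal one of `∏ |H_i(P)|` (`hasFamily_hor`). The
third family consists of `P` alone.

The points of the flagged regions in `S`, and of those that meet an edge of another point, are
undetermined on `P`, since both positions in which they are and are not on the front are possible.
A vertical arrow from `i ∈ S` that neither reaches nor passes another region of `S` leads to a point
which stays near its corner in the first family, and which the `i`-th point may or may not dominate.
If the arrow does reach or pass a region `s ∈ S`, then in the second family the point of `s` keeps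
its abscissa near that of its corner, and the `i`-th point may or may not dominate it. Horizontal
arrows behave symmetrically. So every region of `S` is forced in one of the three families,
and the sum of the three lower bounds exceeds the cost function by at least `3`.
-/

namespace ParetoPre

/-! ### Fronts and the guaranteed boundary -/

theorem Rect.bl_le_tr (R : Rect) : R.bl ≤ R.tr := by
  rcases R.shape with h | h
  · exact ⟨h.1.le, h.2.le⟩
  · exact h.le

theorem Rect.bl_mem (R : Rect) : R.bl ∈ R.toSet := ⟨le_rfl, R.bl_le_tr⟩

theorem Rect.tr_mem (R : Rect) : R.tr ∈ R.toSet := ⟨R.bl_le_tr, le_rfl⟩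

theorem Rect.lt_of_ne {R : Rect} (h : R.bl ≠ R.tr) : R.bl.1 < R.tr.1 ∧ R.bl.2 < R.tr.2 :=
  R.shape.resolve_right h

section Families

variable {ι : Type}

theorem mem_interior_dominated {P : ι → ℝ × ℝ} {q : ℝ × ℝ} :
    q ∈ interior (dominated P) ↔ ∃ i, q.1 < (P i).1 ∧ q.2 < (P i).2 := by
  constructor
  · intro h
    have ht : Filter.Tendsto (fun δ : ℝ => (q.1 + δ, q.2 + δ)) (nhdsWithin 0 (Set.Ioi 0))
        (nhds q) := by
      have : Continuous fun δ : ℝ => (q.1 + δ, q.2 + δ) := by fun_prop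
      have h0 := this.tendsto 0
      simp only [add_zero, Prod.mk.eta] at h0
      exact h0.mono_left nhdsWithin_le_nhds
    obtain ⟨δ, ⟨i, hi⟩, hδ⟩ :=
      ((ht.eventually (mem_interior_iff_mem_nhds.1 h)).and self_mem_nhdsWithin).exists
    have hδ' : 0 < δ := hδ
    have h1 : q.1 + δ ≤ (P i).1 := hi.1
    have h2 : q.2 + δ ≤ (P i).2 := hi.2
    exact ⟨i, by linarith, by linarith⟩
  · rintro ⟨i, h1, h2⟩
    refine mem_interior.2 ⟨{p | p.1 < (P i).1 ∧ p.2 < (P i).2}, ?_, ?_, h1, h2⟩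
    · exact fun p hp => ⟨i, hp.1.le, hp.2.le⟩
    · exact (isOpen_lt continuous_fst continuous_const).inter
        (isOpen_lt continuous_snd continuous_const)

theorem not_lt_of_mem_front {P : ι → ℝ × ℝ} {q : ℝ × ℝ} (h : q ∈ front P) (j : ι) :
    ¬ (q.1 < (P j).1 ∧ q.2 < (P j).2) :=
  fun hj => h.2 (mem_interior_dominated.2 ⟨j, hj⟩)

theorem mem_belowBoundary {R : ι → Rect} {q : ℝ × ℝ} :
    q ∈ belowBoundary R ↔ ∃ i, q.1 < (R i).bl.1 ∧ q.2 < (R i).bl.2 :=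
  mem_interior_dominated

theorem belowBoundary_of_le {R : ι → Rect} {p q : ℝ × ℝ} (h : p ≤ q)
    (hq : q ∈ belowBoundary R) : p ∈ belowBoundary R := by
  obtain ⟨i, h1, h2⟩ := mem_belowBoundary.1 hq
  exact mem_belowBoundary.2 ⟨i, h.1.trans_lt h1, h.2.trans_lt h2⟩

theorem respects_bl {R : ι → Rect} (h : RegionsGeneral R) : Respects R fun i => (R i).bl := by
  refine ⟨fun i => (R i).bl_mem, fun i j hij v hv => h i j hij _ (by simp) v ?_⟩
  simpa using hv

theorem Respects.fst_injective {R : ι → Rect} {P : ι → ℝ × ℝ} (h : Respects R P) :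
    Function.Injective fun i => (P i).1 := by
  intro i j hij
  by_contra hne
  exact (h.2 i j hne (P j) (by simp)).1 hij

/-- The vertices of a region are admissible positions of its point, whatever the other
points are. -/
theorem Respects.update_vertex [DecidableEq ι] {R : ι → Rect} {P : ι → ℝ × ℝ}
    (hR : RegionsGeneral R) (h : Respects R P) (i : ι) {u : ℝ × ℝ}
    (hu : u ∈ ({(R i).bl, (R i).tr} : Set (ℝ × ℝ))) : Respects R (Function.update P i u) := by
  refine ⟨fun j => ?_, fun j k hjk v hv => ?_⟩
  · by_cases hj : j = i
    · subst hj
      rw [Function.update_self]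
      rcases hu with rfl | rfl
      exacts [Rect.bl_mem _, Rect.tr_mem _]
    · rw [Function.update_of_ne hj]
      exact h.1 j
  · by_cases hj : j = i
    · subst hj
      rw [Function.update_self]
      rw [Function.update_of_ne (Ne.symm hjk)] at hv
      rcases hv with rfl | hv
      · have := h.2 k j (Ne.symm hjk) u (by right; exact hu)
        exact ⟨this.1.symm, this.2.symm⟩
      · exact hR j k hjk u hu v hv
    · rw [Function.update_of_ne hj]
      by_cases hk : k = i
      · subst hk
        rw [Function.update_self] at hv
        refine h.2 j k hjk v ?_
        rcases hv with rfl | hv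
        · exact Or.inr hu
        · exact Or.inr hv
      · rw [Function.update_of_ne hk] at hv
        exact h.2 j k hjk v hv

end Families

/-! ### Geometry of truncated sets -/

namespace TruncatedSet

variable {n : ℕ} (R : TruncatedSet n)

theorem general_src : RegionsGeneral fun k => R.orig (R.src k) :=
  fun _ _ hij => R.general _ _ (R.src_injective.ne hij)

theorem disjoint_src {k l : Fin n} (h : k ≠ l) :
    Disjoint (R.orig (R.src k)).toSet (R.orig (R.src l)).toSet :=
  R.disjoint _ _ (R.src_injective.ne h)

/-- The guaranteed boundary is determined by the regions that survive the truncation: a region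
whose bottom left vertex is Pareto-maximal is not negative. -/
theorem exists_src_bl_ge (i : Fin R.m) : ∃ k, (R.orig i).bl ≤ (R.orig (R.src k)).bl := by
  classical
  let s : Finset (Fin R.m) := Finset.univ.filter fun j => (R.orig i).bl ≤ (R.orig j).bl
  obtain ⟨j, hj, hmax⟩ := s.exists_maximalFor (fun j => (R.orig j).bl) ⟨i, by simp [s]⟩
  have hj' : (R.orig i).bl ≤ (R.orig j).bl := by simpa [s] using hj
  have : ¬ IsNegative R.orig j := by
    intro hneg
    refine hneg _ (respects_bl R.general) fun l hl hle => ?_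
    have := hmax (j := l) (by simpa [s] using hj'.trans hle) hle
    exact (R.general j l (Ne.symm hl) _ (by simp) (R.orig l).bl (by simp)).1
      (le_antisymm hle.1 this.1)
  obtain ⟨k, rfl⟩ := (R.src_range j).2 this
  exact ⟨k, hj'⟩

/-- The region has no point below the guaranteed boundary also if it is not flagged. -/
theorem region_toSet (k : Fin n) :
    (R.region k).toSet = (R.orig (R.src k)).toSet \ belowBoundary R.orig := by
  by_cases hf : R.flagged k
  · exact R.region_of_flagged k hf
  have hb : (R.orig (R.src k)).bl ∉ belowBoundary R.orig := by
    intro hb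
    refine hf ((R.flagged_iff k).2 ⟨⟨(R.src_range _).1 ⟨k, rfl⟩, fun hpos => ?_⟩, hb⟩)
    obtain ⟨i, h1, h2⟩ := mem_belowBoundary.1 hb
    refine hpos _ (respects_bl R.general) i ?_ ⟨h1.le, h2.le⟩
    rintro rfl
    exact h1.false
  rw [R.region_of_not_flagged k hf, Set.ext_iff]
  exact fun q => ⟨fun hq => ⟨hq, fun h => hb (belowBoundary_of_le hq.1 h)⟩, fun hq => hq.1⟩

theorem region_subset (k : Fin n) : (R.region k).toSet ⊆ (R.orig (R.src k)).toSet := by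
  rw [R.region_toSet]
  exact Set.sdiff_subset

theorem not_mem_below {k : Fin n} {q : ℝ × ℝ} (h : q ∈ (R.region k).toSet) (i : Fin R.m) :
    ¬ (q.1 < (R.orig i).bl.1 ∧ q.2 < (R.orig i).bl.2) := by
  rw [R.region_toSet] at h
  exact fun hi => h.2 (mem_belowBoundary.2 ⟨i, hi⟩)

theorem exists_of_not_mem {k : Fin n} {q : ℝ × ℝ} (h : q ∈ (R.orig (R.src k)).toSet)
    (h' : q ∉ (R.region k).toSet) : ∃ i, q.1 < (R.orig i).bl.1 ∧ q.2 < (R.orig i).bl.2 := by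
  rw [R.region_toSet] at h'
  by_contra hn
  exact h' ⟨h, fun hb => hn (mem_belowBoundary.1 hb)⟩

theorem orig_bl_le (k : Fin n) : (R.orig (R.src k)).bl ≤ (R.region k).bl :=
  (R.region_subset k (R.region k).bl_mem).1

theorem orig_tr (k : Fin n) : (R.orig (R.src k)).tr = (R.region k).tr := by
  refine le_antisymm ?_ (R.region_subset k (R.region k).tr_mem).2
  have hb := (R.region k).bl_mem
  rw [R.region_toSet] at hb
  have : (R.orig (R.src k)).tr ∈ (R.region k).toSet := by
    rw [R.region_toSet]
    exact ⟨Rect.tr_mem _, fun h => hb.2 (belowBoundary_of_le hb.1.2 h)⟩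
  exact this.2

theorem region_disjoint {k l : Fin n} (h : k ≠ l) {q : ℝ × ℝ} (hk : q ∈ (R.region k).toSet)
    (hl : q ∈ (R.region l).toSet) : False :=
  Set.disjoint_left.1 (R.disjoint_src h) (R.region_subset k hk) (R.region_subset l hl)

/-- If the truncation moves the left side of a region, the new left side lies on a vertical edge
of the guaranteed boundary, whose top vertex is the bottom left vertex of some region. -/
theorem exists_vert_cut {k : Fin n} (h : (R.orig (R.src k)).bl.1 < (R.region k).bl.1) :
    ∃ i, (R.orig i).bl.1 = (R.region k).bl.1 ∧ (R.region k).bl.2 < (R.orig i).bl.2 := by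
  have hb := (R.region k).bl_mem
  have h1 : ∀ᶠ x in nhdsWithin (R.region k).bl.1 (Set.Iio (R.region k).bl.1),
      ∀ i, (R.orig i).bl.1 < (R.region k).bl.1 → (R.orig i).bl.1 < x := by
    refine Filter.eventually_all.2 fun i => ?_
    by_cases hi : (R.orig i).bl.1 < (R.region k).bl.1
    · filter_upwards [nhdsWithin_le_nhds (Ioi_mem_nhds hi)] with x hx _ using hx
    · exact Filter.Eventually.of_forall fun x h => absurd h hi
  obtain ⟨x, ⟨hx1, hx2⟩, hx3⟩ :=
    ((h1.and (nhdsWithin_le_nhds (Ioi_mem_nhds h))).and self_mem_nhdsWithin).exists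
  have hx2' : (R.orig (R.src k)).bl.1 < x := hx2
  have hx3' : x < (R.region k).bl.1 := hx3
  have hb' := R.region_subset k hb
  obtain ⟨i, hi1, hi2⟩ := R.exists_of_not_mem (k := k) (q := (x, (R.region k).bl.2))
    ⟨⟨hx2'.le, hb'.1.2⟩, ⟨hx3'.le.trans hb'.2.1, hb'.2.2⟩⟩
    (fun hm => absurd hm.1.1 (not_le.2 hx3'))
  refine ⟨i, le_antisymm ?_ ?_, hi2⟩
  · by_contra hlt
    exact R.not_mem_below hb i ⟨not_le.1 hlt, hi2⟩
  · by_contra hlt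
    exact absurd (hx1 i (not_le.1 hlt)) (not_lt.2 (le_of_lt hi1))

/-- If the truncation moves the bottom side of a region, the new bottom side lies on a horizontal
edge of the guaranteed boundary. -/
theorem exists_hor_cut {k : Fin n} (h : (R.orig (R.src k)).bl.2 < (R.region k).bl.2) :
    ∃ i, (R.orig i).bl.2 = (R.region k).bl.2 ∧ (R.region k).bl.1 < (R.orig i).bl.1 := by
  have hb := (R.region k).bl_mem
  have h1 : ∀ᶠ y in nhdsWithin (R.region k).bl.2 (Set.Iio (R.region k).bl.2),
      ∀ i, (R.orig i).bl.2 < (R.region k).bl.2 → (R.orig i).bl.2 < y := by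
    refine Filter.eventually_all.2 fun i => ?_
    by_cases hi : (R.orig i).bl.2 < (R.region k).bl.2
    · filter_upwards [nhdsWithin_le_nhds (Ioi_mem_nhds hi)] with y hy _ using hy
    · exact Filter.Eventually.of_forall fun y h => absurd h hi
  obtain ⟨y, ⟨hy1, hy2⟩, hy3⟩ :=
    ((h1.and (nhdsWithin_le_nhds (Ioi_mem_nhds h))).and self_mem_nhdsWithin).exists
  have hy2' : (R.orig (R.src k)).bl.2 < y := hy2
  have hy3' : y < (R.region k).bl.2 := hy3
  have hb' := R.region_subset k hb
  obtain ⟨i, hi1, hi2⟩ := R.exists_of_not_mem (k := k) (q := ((R.region k).bl.1, y))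
    ⟨⟨hb'.1.1, hy2'.le⟩, ⟨hb'.2.1, hy3'.le.trans hb'.2.2⟩⟩
    (fun hm => absurd hm.1.2 (not_le.2 hy3'))
  refine ⟨i, le_antisymm ?_ ?_, hi1⟩
  · by_contra hlt
    exact R.not_mem_below hb i ⟨hi1, not_le.1 hlt⟩
  · by_contra hlt
    exact absurd (hy1 i (not_le.1 hlt)) (not_lt.2 (le_of_lt hi2))

/-- By general position, a truncated region is a single point only if it was one originally. -/
theorem orig_bl_of_degenerate {k : Fin n} (h : (R.region k).bl = (R.region k).tr) :
    (R.orig (R.src k)).bl = (R.region k).bl := by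
  by_contra hne
  have htr := R.orig_tr k
  have hlt := Rect.lt_of_ne (R := R.orig (R.src k)) (by rw [htr, ← h]; exact hne)
  obtain ⟨i, hi, -⟩ := R.exists_vert_cut (k := k) (by rw [h, ← htr]; exact hlt.1)
  by_cases hik : i = R.src k
  · subst hik
    rw [h, ← htr] at hi
    exact hlt.1.ne hi
  · exact (R.general i _ hik (R.orig i).bl (by simp) (R.orig (R.src k)).tr (by simp)).1
      (by rw [hi, h, htr])

/-- The bottom left vertices of the truncated regions do not strictly dominate each other. -/
theorem bl_antichain (k l : Fin n) :
    ¬ ((R.region k).bl.1 < (R.region l).bl.1 ∧ (R.region k).bl.2 < (R.region l).bl.2) := by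
  rintro ⟨h1, h2⟩
  have hk := R.not_mem_below (R.region k).bl_mem
  rcases (R.orig_bl_le l).1.lt_or_eq with hx | hx
  · obtain ⟨i, hi1, hi2⟩ := R.exists_vert_cut hx
    exact hk i ⟨by rw [hi1]; exact h1, h2.trans hi2⟩
  rcases (R.orig_bl_le l).2.lt_or_eq with hy | hy
  · obtain ⟨i, hi1, hi2⟩ := R.exists_hor_cut hy
    exact hk i ⟨h1.trans hi2, by rw [hi1]; exact h2⟩
  exact hk (R.src l) ⟨by rw [hx]; exact h1, by rw [hy]; exact h2⟩

theorem bl_fst_mono {k l : Fin n} (h : k ≤ l) : (R.region k).bl.1 ≤ (R.region l).bl.1 := by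
  rcases h.lt_or_eq with h | rfl
  · rcases R.sorted k l h with h' | h'
    exacts [h'.le, h'.1.le]
  · exact le_rfl

theorem bl_snd_anti {k l : Fin n} (h : k ≤ l) : (R.region l).bl.2 ≤ (R.region k).bl.2 := by
  rcases h.lt_or_eq with h | rfl
  · rcases R.sorted k l h with h' | h'
    · by_contra hlt
      exact R.bl_antichain k l ⟨h', not_le.1 hlt⟩
    · exact h'.2.le
  · exact le_rfl

/-- Left sides of two regions are collinear only if the later region was cut there. -/
theorem ne_of_bl_fst_eq {k l : Fin n} (h : k < l)
    (he : (R.region k).bl.1 = (R.region l).bl.1) : (R.region l).bl ≠ (R.region l).tr := by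
  intro hd
  have hl := R.orig_bl_of_degenerate hd
  have hy : (R.region l).bl.2 < (R.region k).bl.2 := by
    rcases R.sorted k l h with h' | h'
    exacts [absurd he h'.ne, h'.2]
  rcases (R.orig_bl_le k).1.lt_or_eq with hx | hx
  · obtain ⟨i, hi1, hi2⟩ := R.exists_vert_cut hx
    by_cases hil : i = R.src l
    · subst hil
      rw [hl] at hi2
      exact lt_asymm hy hi2
    · exact (R.general i _ hil (R.orig i).bl (by simp) (R.orig (R.src l)).bl (by simp)).1
        (by rw [hi1, he, hl])
  · exact (R.general_src k l h.ne (R.orig (R.src k)).bl (by simp) (R.orig (R.src l)).bl (by simp)).1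
      (by rw [hx, he, hl])

/-- Bottom sides of two regions are collinear only if the earlier region was cut there. -/
theorem ne_of_bl_snd_eq {k l : Fin n} (h : k < l)
    (he : (R.region k).bl.2 = (R.region l).bl.2) : (R.region k).bl ≠ (R.region k).tr := by
  intro hd
  have hk := R.orig_bl_of_degenerate hd
  have hx : (R.region k).bl.1 < (R.region l).bl.1 := by
    rcases R.sorted k l h with h' | h'
    exacts [h', absurd he h'.2.ne']
  rcases (R.orig_bl_le l).2.lt_or_eq with hy | hy
  · obtain ⟨i, hi1, hi2⟩ := R.exists_hor_cut hy
    by_cases hik : i = R.src k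
    · subst hik
      rw [hk] at hi2
      exact lt_asymm hx hi2
    · exact (R.general i _ hik (R.orig i).bl (by simp) (R.orig (R.src k)).bl (by simp)).2
        (by rw [hi1, ← he, hk])
  · exact (R.general_src k l h.ne (R.orig (R.src k)).bl (by simp) (R.orig (R.src l)).bl (by simp)).2
      (by rw [hk, he, hy])

theorem bl_fst_lt_tr_of_vertArrow {i j : Fin n} (h : R.VertArrow i j) :
    (R.region j).bl.1 < (R.region i).tr.1 := by
  obtain ⟨hij, x, y₁, y₂, hi, hj, -⟩ := h
  have hle := R.bl_fst_mono hij.le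
  have hjx : (R.region j).bl.1 ≤ x := by
    rcases hj with hj | hj
    exacts [hj.1.le, hj.1.ge]
  rcases hi with hi | hi
  · exact hjx.trans_lt hi.2
  · have hdi : (R.region i).bl = (R.region i).tr :=
      (R.region i).shape.resolve_left fun h => h.1.ne (hi.1.symm.trans hi.2)
    have he : (R.region i).bl.1 = (R.region j).bl.1 := le_antisymm hle (hjx.trans hi.1.le)
    rcases hj with hj | hj
    · exact absurd (he.trans_lt hj.1) (by rw [hi.1]; exact lt_irrefl _)
    · exact absurd ((R.region j).shape.resolve_left fun h => h.1.ne (hj.1.symm.trans hj.2))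
        (R.ne_of_bl_fst_eq hij he)

theorem bl_snd_lt_tr_of_horArrow {i j : Fin n} (h : R.HorArrow i j) :
    (R.region j).bl.2 < (R.region i).tr.2 := by
  obtain ⟨hij, y, x₁, x₂, hi, hj, -⟩ := h
  have hle := R.bl_snd_anti hij.le
  have hjx : (R.region j).bl.2 ≤ y := by
    rcases hj with hj | hj
    exacts [hj.1.le, hj.1.ge]
  rcases hi with hi | hi
  · exact hjx.trans_lt hi.2
  · have he : (R.region j).bl.2 = (R.region i).bl.2 := le_antisymm (hjx.trans hi.1.le) hle
    rcases hj with hj | hj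
    · exact absurd (hj.1) (by rw [he, hi.1]; exact lt_irrefl _)
    · exact absurd ((R.region j).shape.resolve_left fun h => h.2.ne (hj.1.symm.trans hj.2))
        (R.ne_of_bl_snd_eq hij he)

/-- A region that meets the Pareto front is not dominated by the point of another region. -/
theorem not_tr_le_of_meets_front {P : Fin n → ℝ × ℝ} (hP : R.Respects P) {i : Fin n}
    (h : ((R.region i).toSet ∩ front P).Nonempty) {l : Fin n} (hl : l ≠ i) :
    ¬ (R.region i).tr ≤ P l := by
  obtain ⟨q, hq, hqf⟩ := h
  intro hle
  have hg := hP.2 l i hl (R.orig (R.src i)).tr (by simp)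
  rw [R.orig_tr] at hg
  exact not_lt_of_mem_front hqf l
    ⟨hq.2.1.trans_lt (lt_of_le_of_ne hle.1 hg.1.symm),
      hq.2.2.trans_lt (lt_of_le_of_ne hle.2 hg.2.symm)⟩

/-- The key blocking property. Region `i'` is not dominated by a point of `P` and the regions
counted by `V_i(P)` for some `i < i'` are, so `i'` reaches further to the right than they do;
if one of them came after `i'`, then `i'` would hide it from `i`. -/
theorem lt_of_mem_VP {P : Fin n → ℝ × ℝ} (hP : R.Respects P) {i i' j : Fin n} (hi : i < i')
    (htouch : ∀ l, l ≠ i' → ¬ (R.region i').tr ≤ P l) (hj : j ∈ R.VP P i) (hji : j ≠ i) :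
    j < i' := by
  obtain hj | ⟨hj, l, hli, hle⟩ := hj
  · exact absurd hj hji
  obtain hj | ⟨hij, x, y₁, y₂, hxi, hxj, hy₁, hy₂, hvis⟩ := hj
  · exact absurd hj hji
  by_contra hlt
  rcases (not_lt.1 hlt).lt_or_eq with h | rfl
  swap
  · exact htouch l (hli.trans_lt hi).ne hle
  have hl' : l < i' := hli.trans_lt hi
  -- A point outside its truncated region lies below the guaranteed boundary.
  have hPl : P l ∈ (R.region l).toSet := by
    by_contra hn
    obtain ⟨m, hm1, hm2⟩ := R.exists_of_not_mem (hP.1 l) hn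
    exact R.not_mem_below (R.region j).tr_mem m ⟨hle.1.trans_lt hm1, hle.2.trans_lt hm2⟩
  have hx' : (P l).1 < (R.region i').tr.1 := by
    by_contra hx
    have hy : (P l).2 < (R.region i').tr.2 := by
      by_contra hy
      exact htouch l hl'.ne ⟨not_lt.1 hx, not_lt.1 hy⟩
    refine R.region_disjoint hl'.ne (q := ((R.region i').tr.1, (P l).2)) ⟨⟨?_, ?_⟩, ?_, ?_⟩
      ⟨⟨?_, ?_⟩, ?_, ?_⟩
    · exact (R.bl_fst_mono hl'.le).trans (R.region i').bl_le_tr.1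
    · exact hPl.1.2
    · exact (not_lt.1 hx).trans hPl.2.1
    · exact hPl.2.2
    · exact (R.region i').bl_le_tr.1
    · exact (R.bl_snd_anti hl'.le).trans hPl.1.2
    · exact le_rfl
    · exact hy.le
  have hxl : (R.region i').bl.1 ≤ x := (R.bl_fst_mono h.le).trans hy₂.1.1
  have hxr : x ≤ (R.region i').tr.1 := hy₂.2.1.trans (hle.1.trans hx'.le)
  have hvis' := hvis i' hi.ne' h.ne
  have hb₁ : (R.region i').bl.2 ≤ y₁ := (R.bl_snd_anti hi.le).trans hy₁.1.2
  have hb₂ : (R.region j).bl.2 ≤ (R.region i').bl.2 := R.bl_snd_anti h.le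
  by_cases h2 : y₂ ≤ (R.region i').bl.2
  · exact hvis' _ (Set.mem_uIcc.2 (Or.inr ⟨h2, hb₁⟩))
      ⟨⟨hxl, le_rfl⟩, hxr, (R.region i').bl_le_tr.2⟩
  · exact R.region_disjoint h.ne (q := (x, (R.region i').bl.2))
      ⟨⟨hxl, le_rfl⟩, hxr, (R.region i').bl_le_tr.2⟩
      ⟨⟨hy₂.1.1, hb₂⟩, hy₂.2.1, (not_le.1 h2).le.trans hy₂.2.2⟩

end TruncatedSet

/-! ### Placing the points near the bottom left vertices -/

open Filter Topology in
theorem eventually_add_mul_lt {a b c d : ℝ} (h : a < b ∨ a = b ∧ c < d) :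
    ∀ᶠ ε in 𝓝[>] (0 : ℝ), a + ε * c < b + ε * d := by
  rcases h with h | ⟨rfl, h⟩
  · have h1 : Tendsto (fun ε : ℝ => a + ε * c) (𝓝 0) (𝓝 a) := by
      have : Continuous fun ε : ℝ => a + ε * c := by fun_prop
      simpa using this.tendsto 0
    have h2 : Tendsto (fun ε : ℝ => b + ε * d) (𝓝 0) (𝓝 b) := by
      have : Continuous fun ε : ℝ => b + ε * d := by fun_prop
      simpa using this.tendsto 0
    exact nhdsWithin_le_nhds (h1.eventually_lt h2 h)
  · filter_upwards [self_mem_nhdsWithin] with ε hε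
    have : ε * c < ε * d := mul_lt_mul_of_pos_left h hε
    linarith

open Filter Topology in
theorem eventually_add_mul_ne {a b c d : ℝ} (h : a = b → c ≠ d) :
    ∀ᶠ ε in 𝓝[>] (0 : ℝ), a + ε * c ≠ b + ε * d := by
  rcases lt_trichotomy a b with hab | hab | hab
  · exact (eventually_add_mul_lt (Or.inl hab)).mono fun _ h => h.ne
  · rcases (h hab).lt_or_gt with hcd | hcd
    · exact (eventually_add_mul_lt (Or.inr ⟨hab, hcd⟩)).mono fun _ h => h.ne
    · exact (eventually_add_mul_lt (Or.inr ⟨hab.symm, hcd⟩)).mono fun _ h => h.ne'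
  · exact (eventually_add_mul_lt (Or.inl hab)).mono fun _ h => h.ne'

namespace TruncatedSet

variable {n : ℕ} (R : TruncatedSet n)

/-- A placement of the points with horizontal targets `v`: the points form a chain of decreasing
ordinates close to the bottom sides of their regions, and the abscissa of the `i`-th point is
slightly larger than that of the bottom left vertex of region `v i`. So, for `i < k` with
`v k = k`, the `i`-th point dominates the `k`-th one if and only if `k ≤ v i`. -/
structure IsPlacement (v : Fin n → Fin n) (Q : Fin n → ℝ × ℝ) : Prop where
  respects : R.Respects Q
  le_tr : ∀ i, Q i ≤ (R.region i).tr
  fst_lt : ∀ i k, i < k → v i < v k → (Q i).1 < (Q k).1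
  fst_gt : ∀ i k, i < k → k ≤ v i → v k = k → (Q k).1 < (Q i).1
  snd_lt : ∀ i k, i < k → (Q k).2 < (Q i).2
  bl_fst_lt : ∀ i k, i < k → k ≤ v k → (R.region i).bl.1 < (Q k).1
  bl_snd_lt : ∀ i k, i < k → (R.region k).bl.2 < (Q i).2
  fst_lt_tr : ∀ j i, v j = j → (R.region j).bl.1 < (R.region i).tr.1 →
    (Q j).1 < (R.region i).tr.1
  snd_lt_tr : ∀ j i, (R.region j).bl.2 < (R.region i).tr.2 → (Q j).2 < (R.region i).tr.2

open Classical in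
/-- The rate at which the abscissa of the `i`-th point moves away from that of the bottom left
vertex of its target. The rates of points with a common target differ, and they grow with the
target. Single points cannot be moved. -/
noncomputable def rateFst (v : Fin n → Fin n) (i : Fin n) : ℝ :=
  if (R.region i).bl = (R.region i).tr then 0 else ((n * v i + (n - i) : ℕ) : ℝ)

open Classical in
/-- The rate at which the ordinate of the `i`-th point moves away from that of the bottom left
vertex of its region. -/
noncomputable def rateSnd (i : Fin n) : ℝ :=
  if (R.region i).bl = (R.region i).tr then 0 else ((n - i : ℕ) : ℝ)

variable {R} in
theorem rateFst_nonneg {v : Fin n → Fin n} {i : Fin n} : 0 ≤ R.rateFst v i := by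
  unfold rateFst
  split_ifs <;> positivity

variable {R} in
theorem rateSnd_nonneg {i : Fin n} : 0 ≤ R.rateSnd i := by
  unfold rateSnd
  split_ifs <;> positivity

variable {R} in
theorem rateFst_pos {v : Fin n → Fin n} {i : Fin n} (h : (R.region i).bl ≠ (R.region i).tr) :
    0 < R.rateFst v i := by
  rw [rateFst, if_neg h]
  have := i.2
  exact_mod_cast (by omega : 0 < n * (v i : ℕ) + (n - i))

variable {R} in
theorem rateSnd_pos {i : Fin n} (h : (R.region i).bl ≠ (R.region i).tr) : 0 < R.rateSnd i := by
  rw [rateSnd, if_neg h]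
  have := i.2
  exact_mod_cast (by omega : 0 < n - (i : ℕ))

theorem rate_lt {n a b i k : ℕ} (hk : k < n) (h : a < b ∨ a = b ∧ k < i) (hi : i < n) :
    n * a + (n - i) < n * b + (n - k) := by
  rcases h with h | ⟨rfl, h⟩
  · have : n * (a + 1) ≤ n * b := Nat.mul_le_mul_left n h
    rw [Nat.mul_add] at this
    omega
  · omega

variable {R} in
theorem rateFst_lt {v : Fin n → Fin n} {i k : Fin n}
    (hk : (R.region k).bl ≠ (R.region k).tr) (h : v i < v k ∨ v i = v k ∧ k < i) :
    R.rateFst v i < R.rateFst v k := by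
  by_cases hi : (R.region i).bl = (R.region i).tr
  · rw [rateFst, if_pos hi]
    exact rateFst_pos hk
  · rw [rateFst, rateFst, if_neg hi, if_neg hk]
    refine Nat.cast_lt.2 (rate_lt k.2 ?_ i.2)
    rcases h with h | h
    exacts [Or.inl h, Or.inr ⟨congrArg _ h.1, h.2⟩]

variable {R} in
theorem rateSnd_lt {i k : Fin n} (hi : (R.region i).bl ≠ (R.region i).tr) (h : i < k) :
    R.rateSnd k < R.rateSnd i := by
  by_cases hk : (R.region k).bl = (R.region k).tr
  · rw [rateSnd, if_pos hk]
    exact rateSnd_pos hi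
  · rw [rateSnd, rateSnd, if_neg hi, if_neg hk]
    have := k.2
    have h' : (i : ℕ) < k := h
    exact Nat.cast_lt.2 (by omega)

open Filter Topology in
/-- Placements exist as soon as every region reaches further to the right than the left side of
its target. The points are moved away from the corners given by the targets by a small multiple `ε`
of the rates, so that every required inequality is decided by the corners or, where these are
collinear, by the rates, and holds for all sufficiently small `ε > 0`. -/
theorem exists_isPlacement (v : Fin n → Fin n) (hv : ∀ i, i ≤ v i)
    (hv' : ∀ i, v i ≠ i → (R.region (v i)).bl.1 < (R.region i).tr.1) :
    ∃ Q, R.IsPlacement v Q := by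
  -- A single point is its own target.
  have hdeg : ∀ i, (R.region i).bl = (R.region i).tr → v i = i := by
    intro i hi
    by_contra h
    have h1 := hv' i h
    rw [← hi] at h1
    exact absurd (R.bl_fst_mono (hv i)) (not_le.2 h1)
  set X : Fin n → ℝ := fun i => (R.region (v i)).bl.1 with hX
  set Y : Fin n → ℝ := fun i => (R.region i).bl.2 with hY
  have e1 : ∀ᶠ ε in 𝓝[>] (0 : ℝ), ∀ i k, i < k → v i < v k →
      X i + ε * R.rateFst v i < X k + ε * R.rateFst v k := by
    simp only [eventually_all]
    intro i k _ hvk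
    apply eventually_add_mul_lt
    rcases (R.bl_fst_mono hvk.le).lt_or_eq with h | h
    · exact Or.inl h
    refine Or.inr ⟨h, rateFst_lt ?_ (Or.inl hvk)⟩
    intro hk
    have := R.ne_of_bl_fst_eq hvk h
    rw [hdeg k hk] at this
    exact this hk
  have e2 : ∀ᶠ ε in 𝓝[>] (0 : ℝ), ∀ i k, i < k → k ≤ v i → v k = k →
      X k + ε * R.rateFst v k < X i + ε * R.rateFst v i := by
    simp only [eventually_all]
    intro i k hik hk hvk
    have hi : (R.region i).bl ≠ (R.region i).tr := by
      intro hi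
      rw [hdeg i hi] at hk
      exact absurd hik (not_lt.2 hk)
    apply eventually_add_mul_lt
    have hle : X k ≤ X i := by
      simp only [hX, hvk]
      exact R.bl_fst_mono hk
    rcases hle.lt_or_eq with h | h
    · exact Or.inl h
    refine Or.inr ⟨h, rateFst_lt hi ?_⟩
    rw [hvk]
    rcases hk.lt_or_eq with h | h
    exacts [Or.inl h, Or.inr ⟨h, hik⟩]
  have e3 : ∀ᶠ ε in 𝓝[>] (0 : ℝ), ∀ i k, i < k →
      Y k + ε * R.rateSnd k < Y i + ε * R.rateSnd i := by
    simp only [eventually_all]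
    intro i k hik
    apply eventually_add_mul_lt
    rcases (R.bl_snd_anti hik.le).lt_or_eq with h | h
    · exact Or.inl h
    · exact Or.inr ⟨h, rateSnd_lt (R.ne_of_bl_snd_eq hik h.symm) hik⟩
  have e4 : ∀ᶠ ε in 𝓝[>] (0 : ℝ), ∀ i k, i < k → k ≤ v k →
      (R.region i).bl.1 + ε * 0 < X k + ε * R.rateFst v k := by
    simp only [eventually_all]
    intro i k hik hk
    apply eventually_add_mul_lt
    rcases (R.bl_fst_mono (hik.le.trans hk)).lt_or_eq with h | h
    · exact Or.inl h
    refine Or.inr ⟨h, rateFst_pos fun hd => ?_⟩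
    have := R.ne_of_bl_fst_eq (hik.trans_le hk) h
    rw [hdeg k hd] at this
    exact this hd
  have e5 : ∀ᶠ ε in 𝓝[>] (0 : ℝ), ∀ i k, i < k →
      Y k + ε * 0 < Y i + ε * R.rateSnd i := by
    simp only [eventually_all]
    intro i k hik
    apply eventually_add_mul_lt
    rcases (R.bl_snd_anti hik.le).lt_or_eq with h | h
    · exact Or.inl h
    · exact Or.inr ⟨h, rateSnd_pos (R.ne_of_bl_snd_eq hik h.symm)⟩
  have e6 : ∀ᶠ ε in 𝓝[>] (0 : ℝ), ∀ j i, X j < (R.region i).tr.1 →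
      X j + ε * R.rateFst v j < (R.region i).tr.1 + ε * 0 := by
    simp only [eventually_all]
    exact fun i k h => eventually_add_mul_lt (Or.inl h)
  have e7 : ∀ᶠ ε in 𝓝[>] (0 : ℝ), ∀ j i, Y j < (R.region i).tr.2 →
      Y j + ε * R.rateSnd j < (R.region i).tr.2 + ε * 0 := by
    simp only [eventually_all]
    exact fun i k h => eventually_add_mul_lt (Or.inl h)
  have e8 : ∀ᶠ ε in 𝓝[>] (0 : ℝ), ∀ i k, i ≠ k →
      X i + ε * R.rateFst v i ≠ X k + ε * R.rateFst v k := by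
    simp only [eventually_all]
    intro i k hik
    apply eventually_add_mul_ne
    intro hXX
    by_cases hi : (R.region i).bl = (R.region i).tr
    · by_cases hk : (R.region k).bl = (R.region k).tr
      · simp only [hX, hdeg i hi, hdeg k hk] at hXX
        rcases hik.lt_or_gt with h | h
        · exact absurd hk (R.ne_of_bl_fst_eq h hXX)
        · exact absurd hi (R.ne_of_bl_fst_eq h hXX.symm)
      · rw [rateFst, if_pos hi]
        exact (rateFst_pos hk).ne
    · rcases lt_trichotomy (v i) (v k) with h | h | h
      · by_cases hk : (R.region k).bl = (R.region k).tr
        · nth_rw 2 [rateFst]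
          rw [if_pos hk]
          exact (rateFst_pos hi).ne'
        · exact (rateFst_lt hk (Or.inl h)).ne
      · rcases hik.lt_or_gt with h' | h'
        · exact (rateFst_lt hi (Or.inr ⟨h.symm, h'⟩)).ne'
        · by_cases hk : (R.region k).bl = (R.region k).tr
          · nth_rw 2 [rateFst]
            rw [if_pos hk]
            exact (rateFst_pos hi).ne'
          · exact (rateFst_lt hk (Or.inr ⟨h, h'⟩)).ne
      · exact (rateFst_lt hi (Or.inl h)).ne'
  have hvert : ∀ i k, i ≠ k → (R.region i).bl = (R.region i).tr →
      ∀ u ∈ ({(R.orig (R.src k)).bl, (R.orig (R.src k)).tr} : Set (ℝ × ℝ)),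
        (R.region i).bl.1 ≠ u.1 ∧ (R.region i).bl.2 ≠ u.2 := by
    intro i k hik hi u hu
    have := R.general_src i k hik (R.orig (R.src i)).bl (by simp) u hu
    rwa [R.orig_bl_of_degenerate hi] at this
  have e9 : ∀ᶠ ε in 𝓝[>] (0 : ℝ), ∀ i k, i ≠ k →
      (X i + ε * R.rateFst v i ≠ (R.orig (R.src k)).bl.1 + ε * 0 ∧
        Y i + ε * R.rateSnd i ≠ (R.orig (R.src k)).bl.2 + ε * 0) ∧
      (X i + ε * R.rateFst v i ≠ (R.orig (R.src k)).tr.1 + ε * 0 ∧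
        Y i + ε * R.rateSnd i ≠ (R.orig (R.src k)).tr.2 + ε * 0) := by
    simp only [eventually_all, eventually_and]
    intro i k hik
    by_cases hi : (R.region i).bl = (R.region i).tr
    · have h := hvert i k hik hi
      simp only [hX, hY, hdeg i hi]
      exact ⟨⟨eventually_add_mul_ne fun he => absurd he (h _ (by simp)).1,
        eventually_add_mul_ne fun he => absurd he (h _ (by simp)).2⟩,
        eventually_add_mul_ne fun he => absurd he (h _ (by simp)).1,
        eventually_add_mul_ne fun he => absurd he (h _ (by simp)).2⟩
    · have h1 := (rateFst_pos (v := v) hi).ne'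
      have h2 := (rateSnd_pos hi).ne'
      exact ⟨⟨eventually_add_mul_ne fun _ => h1, eventually_add_mul_ne fun _ => h2⟩,
        eventually_add_mul_ne fun _ => h1, eventually_add_mul_ne fun _ => h2⟩
  obtain ⟨ε, ⟨⟨⟨⟨⟨⟨⟨⟨⟨e1, e2⟩, e3⟩, e4⟩, e5⟩, e6⟩, e7⟩, e8⟩, e9⟩, hε⟩⟩ :=
    (((((((((e1.and e2).and e3).and e4).and e5).and e6).and e7).and e8).and e9).and
      self_mem_nhdsWithin).exists
  have hε : 0 < ε := hε
  simp only [mul_zero, add_zero] at e4 e5 e6 e7 e9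
  set Q : Fin n → ℝ × ℝ := fun i => (X i + ε * R.rateFst v i, Y i + ε * R.rateSnd i) with hQ
  have hbl : ∀ i, (R.region i).bl ≤ Q i := by
    intro i
    have h1 : (R.region i).bl.1 ≤ X i := R.bl_fst_mono (hv i)
    have h2 := mul_nonneg hε.le (rateFst_nonneg (R := R) (v := v) (i := i))
    have h3 := mul_nonneg hε.le (rateSnd_nonneg (R := R) (i := i))
    exact ⟨by simp only [hQ]; linarith, by simp only [hQ, hY]; linarith⟩
  have htr : ∀ i, Q i ≤ (R.region i).tr := by
    intro i
    by_cases hi : (R.region i).bl = (R.region i).tr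
    · simp only [hQ, hX, hY, hdeg i hi, rateFst, rateSnd, if_pos hi, mul_zero, add_zero]
      exact hi.le
    · have hlt := Rect.lt_of_ne hi
      refine ⟨(e6 i i ?_).le, (e7 i i hlt.2).le⟩
      by_cases h : v i = i
      · simp only [hX, h, hlt.1]
      · exact hv' i h
  refine ⟨Q, ⟨⟨?_, ?_⟩, htr, e1, e2, e3, e4, e5, ?_, e7⟩⟩
  · exact fun i => R.region_subset i ⟨hbl i, htr i⟩
  · intro i k hik u hu
    rcases hu with rfl | rfl | rfl
    · refine ⟨e8 i k hik, ?_⟩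
      rcases hik.lt_or_gt with h | h
      exacts [(e3 i k h).ne', (e3 k i h).ne]
    · exact (e9 i k hik).1
    · exact (e9 i k hik).2
  · intro j i hj h
    refine e6 j i ?_
    simp only [hX, hj, h]

/-! ### Families of point sets that force retrievals -/

/-- The combinatorial Pareto front depends on the position of the `i`-th point, even if all other
points of `P` are known: two admissible positions lead to different sets of indices on the
front. -/
def Undetermined (P : Fin n → ℝ × ℝ) (i : Fin n) : Prop :=
  ∃ a b k, R.Respects (Function.update P i a) ∧ R.Respects (Function.update P i b) ∧
    OnFront (Function.update P i a) k ∧ ¬ OnFront (Function.update P i b) k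

/-- There are `N` point sets with different combinatorial Pareto fronts, in each of which all the
points with index in `K` are undetermined. -/
def HasFamily (N : ℕ) (K : Set (Fin n)) : Prop :=
  ∃ Q : Fin N → Fin n → ℝ × ℝ, (∀ a, R.Respects (Q a)) ∧
    (∀ a b, (∀ k, OnFront (Q a) k ↔ OnFront (Q b) k) → a = b) ∧
    ∀ a, ∀ i ∈ K, R.Undetermined (Q a) i

variable {R}

theorem respects_update_bl {P : Fin n → ℝ × ℝ} (hP : R.Respects P) (i : Fin n) :
    R.Respects (Function.update P i (R.orig (R.src i)).bl) :=
  Respects.update_vertex R.general_src hP i (by simp)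

theorem respects_update_tr {P : Fin n → ℝ × ℝ} (hP : R.Respects P) (i : Fin n) :
    R.Respects (Function.update P i (R.region i).tr) :=
  Respects.update_vertex R.general_src hP i (by simp [R.orig_tr])

/-- If no other point dominates region `i`, but some other point dominates its original bottom left
vertex, then the `i`-th point itself may or may not be on the front. -/
theorem undetermined_of_bl_le {P : Fin n → ℝ × ℝ} (hP : R.Respects P) {i j : Fin n}
    (htouch : ∀ l, l ≠ i → ¬ (R.region i).tr ≤ P l) (hj : j ≠ i)
    (h : (R.orig (R.src i)).bl ≤ P j) : R.Undetermined P i := by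
  refine ⟨_, _, i, respects_update_tr hP i, respects_update_bl hP i, fun l hl => ?_, fun hb => ?_⟩
  · rw [Function.update_self, Function.update_of_ne hl]
    exact htouch l hl
  · apply hb j hj
    rwa [Function.update_self, Function.update_of_ne hj]

/-- If no further point dominates the `j`-th one, then the `i`-th point decides whether it is on the
front, provided that the top right vertex of region `i` dominates it and the bottom left vertex does
not. -/
theorem undetermined_of_le_tr {P : Fin n → ℝ × ℝ} (hP : R.Respects P) {i j : Fin n}
    (hj : j ≠ i) (h : P j ≤ (R.region i).tr) (hbl : ¬ P j ≤ (R.region i).bl)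
    (hother : ∀ k, k ≠ i → k ≠ j → ¬ P j ≤ P k) : R.Undetermined P i := by
  refine ⟨_, _, j, respects_update_bl hP i, respects_update_tr hP i, fun l hl => ?_, fun hb => ?_⟩
  · rw [Function.update_of_ne hj]
    by_cases hli : l = i
    · subst hli
      rw [Function.update_self]
      exact fun hle => hbl (hle.trans (R.orig_bl_le l))
    · rw [Function.update_of_ne hli]
      exact hother l hli hl
  · apply hb i (Ne.symm hj)
    rwa [Function.update_self, Function.update_of_ne hj]

/-- On `P` itself the flagged regions and those which meet an edge of another point are
undetermined. -/
theorem undetermined_of_flagged_or_edge {P : Fin n → ℝ × ℝ} (hP : R.Respects P) {i : Fin n}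
    (htouch : ∀ l, l ≠ i → ¬ (R.region i).tr ≤ P l)
    (h : R.flagged i ∨ ∃ j, j ≠ i ∧ OnFront P j ∧
      ((R.region i).toSet ∩ (vertEdge P j ∪ horEdge P j)).Nonempty) : R.Undetermined P i := by
  rcases h with h | ⟨j, hj, -, q, hq, hqj⟩
  · obtain ⟨m, hm1, hm2⟩ := mem_belowBoundary.1 ((R.flagged_iff i).1 h).2
    obtain ⟨k, hk⟩ := R.exists_src_bl_ge m
    refine undetermined_of_bl_le hP htouch (j := k) ?_ ?_
    · rintro rfl
      exact absurd (hm1.trans_le hk.1) (lt_irrefl _)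
    · have := (hP.1 k).1
      exact ⟨(hm1.le.trans hk.1).trans this.1, (hm2.le.trans hk.2).trans this.2⟩
  · refine undetermined_of_bl_le hP htouch hj ((R.orig_bl_le i).trans (hq.1.trans ?_))
    rcases hqj with h | h
    · exact ⟨h.2.1.le, h.2.2⟩
    · exact ⟨h.2.2, h.2.1.le⟩

theorem hasFamily_one {P : Fin n → ℝ × ℝ} (hP : R.Respects P) {K : Set (Fin n)}
    (h : ∀ i ∈ K, R.Undetermined P i) : R.HasFamily 1 K :=
  ⟨fun _ => P, fun _ => hP, fun _ _ _ => Subsingleton.elim _ _, fun _ => h⟩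

namespace IsPlacement

variable {v : Fin n → Fin n} {Q : Fin n → ℝ × ℝ}

theorem not_le_of_lt (hQ : R.IsPlacement v Q) {j k : Fin n} (h : k < j → v k < v j)
    (hne : k ≠ j) : ¬ Q j ≤ Q k := by
  intro hle
  rcases hne.lt_or_gt with hlt | hlt
  · exact absurd hle.1 (not_le.2 (hQ.fst_lt k j hlt (h hlt)))
  · exact absurd hle.2 (not_le.2 (hQ.snd_lt j k hlt))

theorem onFront (hQ : R.IsPlacement v Q) {j : Fin n} (h : ∀ k, k < j → v k < v j) :
    OnFront Q j :=
  fun k hk => hQ.not_le_of_lt (h k) hk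

theorem not_onFront (hQ : R.IsPlacement v Q) {i k : Fin n} (hik : i < k) (hk : k ≤ v i)
    (hvk : v k = k) : ¬ OnFront Q k :=
  fun h => h i hik.ne ⟨(hQ.fst_gt i k hik hk hvk).le, (hQ.snd_lt i k hik).le⟩

end IsPlacement

variable (R) in
/-- The regions forced by horizontal choices: those with a vertical arrow which neither reaches nor
passes a later region of `S`, and those with a horizontal arrow which reaches or passes an earlier
one. -/
def VertForced (S : Finset (Fin n)) (i : Fin n) : Prop :=
  i ∈ S ∧ ((∃ j, R.VertArrow i j ∧ ∀ s ∈ S, i < s → j < s) ∨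
    ∃ j, R.HorArrow i j ∧ ∃ s ∈ S, j ≤ s ∧ s < i)

open Classical in
/-- Every region `i` of `S` independently chooses a region `v i` of `V_i(P)`, up to which its point
dominates the points with target `v k = k`. Different choices lead to different fronts, since the
blocking property `lt_of_mem_VP` separates the sets `V_i(P)`. -/
theorem hasFamily_vert {P : Fin n → ℝ × ℝ} (hP : R.Respects P) (S : Finset (Fin n))
    (htouch : ∀ i ∈ S, ∀ l, l ≠ i → ¬ (R.region i).tr ≤ P l) :
    R.HasFamily (∏ i ∈ S, (R.VP P i).ncard) {i | R.VertForced S i} := by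
  set D : Finset (Fin n → Fin n) :=
    Fintype.piFinset fun i => if i ∈ S then (R.VP P i).toFinset else {i} with hD
  have hcard : D.card = ∏ i ∈ S, (R.VP P i).ncard := by
    rw [hD, Fintype.card_piFinset, ← Finset.prod_subset (Finset.subset_univ S)]
    · refine Finset.prod_congr rfl fun i hi => ?_
      rw [if_pos hi, Set.ncard_eq_toFinset_card']
    · intro i _ hi
      rw [if_neg hi, Finset.card_singleton]
  have hVP : ∀ i, ∀ j ∈ R.VP P i, j ≠ i → R.VertArrow i j := by
    rintro i j (h | ⟨h | h, -⟩) hne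
    exacts [absurd h hne, absurd h hne, h]
  have hmem : ∀ v ∈ D, ∀ i ∈ S, v i ∈ R.VP P i := by
    intro v hv i hi
    have := Fintype.mem_piFinset.1 hv i
    rwa [if_pos hi, Set.mem_toFinset] at this
  have hid : ∀ v ∈ D, ∀ i, i ∉ S → v i = i := by
    intro v hv i hi
    have := Fintype.mem_piFinset.1 hv i
    rwa [if_neg hi, Finset.mem_singleton] at this
  have harrow : ∀ v ∈ D, ∀ i, v i ≠ i → R.VertArrow i (v i) := by
    intro v hv i hne
    by_cases hi : i ∈ S
    · exact hVP i _ (hmem v hv i hi) hne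
    · exact absurd (hid v hv i hi) hne
  have hge : ∀ v ∈ D, ∀ i, i ≤ v i := by
    intro v hv i
    by_cases h : v i = i
    · exact h.ge
    · exact (harrow v hv i h).1.le
  -- Blocking: a target does not pass a region of `S`.
  have hblock : ∀ v ∈ D, ∀ k, ∀ i ∈ S, k < i → v k < i := by
    intro v hv k i hi hki
    by_cases h : v k = k
    · rwa [h]
    · by_cases hk : k ∈ S
      · exact R.lt_of_mem_VP hP hki (htouch i hi) (hmem v hv k hk) h
      · exact absurd (hid v hv k hk) h
  have hex : ∀ v : D, ∃ Q, R.IsPlacement v Q := fun v =>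
    R.exists_isPlacement v (hge v v.2) fun i h => R.bl_fst_lt_tr_of_vertArrow (harrow v v.2 i h)
  choose Q hQ using hex
  have hfront : ∀ v w : D, ∀ i, v.1 i < w.1 i → OnFront (Q v) (w.1 i) ∧
      ¬ OnFront (Q w) (w.1 i) := by
    intro v w i hlt
    have hiS : i ∈ S := by
      by_contra hi
      rw [hid v v.2 i hi, hid w w.2 i hi] at hlt
      exact lt_irrefl _ hlt
    have hik : i < w.1 i := (hge v v.2 i).trans_lt hlt
    have hk : ∀ s ∈ S, i < s → w.1 i < s := fun s hs his => hblock w w.2 i s hs his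
    have hkS : w.1 i ∉ S := fun h => absurd (hk _ h hik) (lt_irrefl _)
    constructor
    · refine (hQ v).onFront fun k hkw => ?_
      rw [hid v v.2 _ hkS]
      rcases lt_trichotomy k i with h | rfl | h
      · exact (hblock v v.2 k i hiS h).trans hik
      · exact hlt
      · rw [hid v v.2 k fun hkS => absurd (hk k hkS h) (not_lt.2 hkw.le)]
        exact hkw
    · exact (hQ w).not_onFront hik le_rfl (hid w w.2 _ hkS)
  rw [← hcard]
  refine ⟨fun a => Q (D.equivFin.symm a), fun a => (hQ _).respects, fun a b hab => ?_, ?_⟩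
  · apply D.equivFin.symm.injective
    apply Subtype.ext
    funext i
    by_contra hne
    rcases lt_or_gt_of_ne hne with h | h
    · have := hfront _ _ i h
      exact this.2 ((hab _).1 this.1)
    · have := hfront _ _ i h
      exact this.2 ((hab _).2 this.1)
  · rintro a i ⟨hi, h⟩
    change R.Undetermined (Q (D.equivFin.symm a)) i
    generalize D.equivFin.symm a = v
    rcases h with ⟨j, hij, hjS⟩ | ⟨j, hij, s, hs, hjs, hsi⟩
    · have hj : v.1 j = j := hid v v.2 j fun h => absurd (hjS j h hij.1) (lt_irrefl _)
      refine undetermined_of_le_tr (hQ v).respects hij.1.ne' ⟨?_, ?_⟩ ?_ ?_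
      · exact ((hQ v).fst_lt_tr j i hj (R.bl_fst_lt_tr_of_vertArrow hij)).le
      · exact ((hQ v).snd_lt i j hij.1).le.trans ((hQ v).le_tr i).2
      · exact fun hle => absurd hle.1 (not_le.2 ((hQ v).bl_fst_lt i j hij.1 hj.ge))
      · intro k hki hkj
        refine (hQ v).not_le_of_lt (fun hlt => ?_) hkj
        rw [hj]
        rcases hki.lt_or_gt with h | h
        · exact (hblock v v.2 k i hi h).trans hij.1
        · rw [hid v v.2 k fun hkS => absurd (hjS k hkS h) (not_lt.2 hlt.le)]
          exact hlt
    · have hchain : ∀ t ∈ S, ∀ k, k < t → v.1 k < v.1 t := fun t ht k hkt =>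
        (hblock v v.2 k t ht hkt).trans_le (hge v v.2 t)
      refine undetermined_of_le_tr (hQ v).respects hsi.ne ⟨?_, ?_⟩ ?_ ?_
      · exact ((hQ v).fst_lt s i hsi (hchain i hi s hsi)).le.trans ((hQ v).le_tr i).1
      · exact ((hQ v).snd_lt_tr s i ((R.bl_snd_anti hjs).trans_lt
          (R.bl_snd_lt_tr_of_horArrow hij))).le
      · exact fun hle => absurd hle.2 (not_le.2 ((hQ v).bl_snd_lt s i hsi))
      · exact fun k _ hks => (hQ v).not_le_of_lt (hchain s hs k) hks

end TruncatedSet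

/-! ### Reflection in the diagonal -/

/-- The mirror image of a rectangle in the diagonal. -/
def Rect.mirror (R : Rect) : Rect where
  bl := R.bl.swap
  tr := R.tr.swap
  shape := R.shape.imp And.symm (congrArg Prod.swap)

theorem Rect.mem_mirror {R : Rect} {q : ℝ × ℝ} : q ∈ R.mirror.toSet ↔ q.swap ∈ R.toSet :=
  and_congr Prod.swap_le_swap.symm Prod.swap_le_swap.symm

section Families

variable {ι : Type}

theorem onFront_mirror {P : ι → ℝ × ℝ} {i : ι} :
    OnFront (fun k => (P k).swap) i ↔ OnFront P i :=
  forall₂_congr fun _ _ => not_congr Prod.swap_le_swap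

theorem respects_mirror {R : ι → Rect} {P : ι → ℝ × ℝ} :
    Respects (fun k => (R k).mirror) (fun k => (P k).swap) ↔ Respects R P := by
  refine and_congr (forall_congr' fun i => by rw [Rect.mem_mirror, Prod.swap_swap])
    (forall₃_congr fun i j _ => ?_)
  simp only [Set.mem_insert_iff, Set.mem_singleton_iff, forall_eq_or_imp, forall_eq, Rect.mirror,
    Prod.fst_swap, Prod.snd_swap]
  tauto

theorem regionsGeneral_mirror {R : ι → Rect} (h : RegionsGeneral R) :
    RegionsGeneral fun k => (R k).mirror := by
  intro i j hij
  have := h i j hij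
  simp only [Set.mem_insert_iff, Set.mem_singleton_iff, forall_eq_or_imp, forall_eq, Rect.mirror,
    Prod.fst_swap, Prod.snd_swap] at this ⊢
  tauto

theorem forall_respects_mirror {R : ι → Rect} {p : (ι → ℝ × ℝ) → Prop} :
    (∀ P, Respects (fun k => (R k).mirror) P → p P) ↔
      ∀ P, Respects R P → p fun k => (P k).swap := by
  refine ⟨fun h P hP => h _ (respects_mirror.2 hP), fun h P hP => ?_⟩
  have := h (fun k => (P k).swap) (respects_mirror.1 (by simpa only [Prod.swap_swap] using hP))
  simpa only [Prod.swap_swap] using this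

theorem isNegative_mirror {R : ι → Rect} {i : ι} :
    IsNegative (fun k => (R k).mirror) i ↔ IsNegative R i := by
  unfold IsNegative
  rw [forall_respects_mirror]
  simp only [onFront_mirror]

theorem isPotential_mirror {R : ι → Rect} {i : ι} :
    IsPotential (fun k => (R k).mirror) i ↔ IsPotential R i := by
  unfold IsPotential IsPositive
  rw [isNegative_mirror, forall_respects_mirror]
  simp only [onFront_mirror]

theorem mem_belowBoundary_mirror {R : ι → Rect} {q : ℝ × ℝ} :
    q ∈ belowBoundary (fun k => (R k).mirror) ↔ q.swap ∈ belowBoundary R := by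
  rw [mem_belowBoundary, mem_belowBoundary]
  exact exists_congr fun _ => and_comm

end Families

namespace TruncatedSet

variable {n : ℕ} (R : TruncatedSet n)

/-- The mirror image of a truncated set in the diagonal. The order of the regions is reversed, and
vertical and horizontal arrows are interchanged. -/
def mirror : TruncatedSet n where
  m := R.m
  orig i := (R.orig i).mirror
  disjoint i j h := by
    rw [Set.disjoint_left]
    intro q hi hj
    exact Set.disjoint_left.1 (R.disjoint i j h) (Rect.mem_mirror.1 hi) (Rect.mem_mirror.1 hj)
  general := regionsGeneral_mirror R.general
  src k := R.src k.rev
  src_injective := R.src_injective.comp Fin.rev_injective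
  src_range i := by
    rw [isNegative_mirror, ← R.src_range]
    exact ⟨fun ⟨k, hk⟩ => ⟨k.rev, hk⟩, fun ⟨k, hk⟩ => ⟨k.rev, by simpa using hk⟩⟩
  flagged k := R.flagged k.rev
  flagged_iff k := by
    rw [isPotential_mirror, mem_belowBoundary_mirror]
    exact R.flagged_iff k.rev
  region k := (R.region k.rev).mirror
  region_of_flagged k h := by
    ext q
    rw [Set.mem_sdiff, mem_belowBoundary_mirror, Rect.mem_mirror, Rect.mem_mirror,
      R.region_of_flagged _ h, Set.mem_sdiff]
  region_of_not_flagged k h := by rw [R.region_of_not_flagged _ h]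
  sorted k l h := by
    have h' : l.rev < k.rev := Fin.rev_lt_rev.2 h
    change (R.region k.rev).bl.2 < (R.region l.rev).bl.2 ∨
      (R.region k.rev).bl.2 = (R.region l.rev).bl.2 ∧
        (R.region l.rev).bl.1 < (R.region k.rev).bl.1
    rcases (R.bl_snd_anti h'.le).lt_or_eq with hy | hy
    · exact Or.inl hy
    · refine Or.inr ⟨hy, ?_⟩
      rcases R.sorted _ _ h' with hx | hx
      exacts [hx, absurd hy hx.2.ne]

/-- The mirror image of a point set, indexed like the mirror image of the regions. -/
def mirrorPts (P : Fin n → ℝ × ℝ) : Fin n → ℝ × ℝ := fun k => (P k.rev).swap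

theorem mirrorPts_mirrorPts (P : Fin n → ℝ × ℝ) : mirrorPts (mirrorPts P) = P := by
  funext k
  simp [mirrorPts]

theorem mirrorPts_update (P : Fin n → ℝ × ℝ) (i : Fin n) (a : ℝ × ℝ) :
    mirrorPts (Function.update P i a) = Function.update (mirrorPts P) i.rev a.swap := by
  funext k
  by_cases h : k = i.rev
  · subst h
    simp [mirrorPts]
  · have h' : k.rev ≠ i := fun h' => h (by rw [← h', Fin.rev_rev])
    simp [mirrorPts, h, h']

theorem onFront_mirrorPts {P : Fin n → ℝ × ℝ} {i : Fin n} :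
    OnFront (mirrorPts P) i ↔ OnFront P i.rev := by
  refine ⟨fun h j hj hle => ?_, fun h j hj hle => ?_⟩
  · refine h j.rev (fun h' => hj (by rw [← h', Fin.rev_rev])) ?_
    simpa [mirrorPts] using hle
  · exact h j.rev (Fin.rev_injective.ne hj) (Prod.swap_le_swap.1 hle)

variable {R}

theorem respects_mirrorPts {P : Fin n → ℝ × ℝ} :
    R.mirror.Respects (mirrorPts P) ↔ R.Respects P := by
  have h : ∀ {Q : Fin n → ℝ × ℝ} {O : Fin n → Rect}, ParetoPre.Respects O Q →
      ParetoPre.Respects (fun k : Fin n => O k.rev) fun k : Fin n => Q k.rev := fun h =>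
    ⟨fun i => h.1 i.rev, fun i j hij => h.2 _ _ (Fin.rev_injective.ne hij)⟩
  refine (respects_mirror (R := fun k : Fin n => R.orig (R.src k.rev))
    (P := fun k : Fin n => P k.rev)).trans ⟨fun h' => ?_, h⟩
  simpa [TruncatedSet.Respects] using h h'

theorem respects_mirror_iff {P : Fin n → ℝ × ℝ} :
    R.mirror.Respects P ↔ R.Respects (mirrorPts P) := by
  rw [← respects_mirrorPts (R := R) (P := mirrorPts P), mirrorPts_mirrorPts]

theorem undetermined_mirrorPts {P : Fin n → ℝ × ℝ} {i : Fin n}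
    (h : R.mirror.Undetermined P i) : R.Undetermined (mirrorPts P) i.rev := by
  obtain ⟨a, b, k, ha, hb, hka, hkb⟩ := h
  refine ⟨a.swap, b.swap, k.rev, ?_, ?_, ?_, ?_⟩
  · rwa [← mirrorPts_update, ← respects_mirror_iff]
  · rwa [← mirrorPts_update, ← respects_mirror_iff]
  · rwa [← mirrorPts_update, onFront_mirrorPts, Fin.rev_rev]
  · rwa [← mirrorPts_update, onFront_mirrorPts, Fin.rev_rev]

theorem HasFamily.of_mirror {N : ℕ} {K : Set (Fin n)} (h : R.mirror.HasFamily N K) :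
    R.HasFamily N {i | i.rev ∈ K} := by
  obtain ⟨Q, h1, h2, h3⟩ := h
  refine ⟨fun a => mirrorPts (Q a), fun a => respects_mirror_iff.1 (h1 a), fun a b hab => ?_,
    fun a i hi => ?_⟩
  · refine h2 a b fun k => ?_
    have := hab k.rev
    rwa [onFront_mirrorPts, onFront_mirrorPts, Fin.rev_rev] at this
  · have := undetermined_mirrorPts (h3 a i.rev hi)
    rwa [Fin.rev_rev] at this

theorem vertArrow_mirror {i j : Fin n} : R.mirror.VertArrow i j ↔ R.HorArrow i.rev j.rev := by
  refine and_congr Fin.rev_lt_rev.symm (exists₃_congr fun x y₁ y₂ => ?_)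
  refine and_congr Iff.rfl (and_congr Iff.rfl (and_congr Rect.mem_mirror (and_congr Rect.mem_mirror
    ⟨fun h k hi hj y hy hm => ?_, fun h k hi hj y hy hm => ?_⟩)))
  · refine h k.rev (fun h' => hi (by rw [← h', Fin.rev_rev]))
      (fun h' => hj (by rw [← h', Fin.rev_rev])) y hy (Rect.mem_mirror.2 ?_)
    simpa using hm
  · exact h k.rev (Fin.rev_injective.ne hi) (Fin.rev_injective.ne hj) y hy (Rect.mem_mirror.1 hm)

theorem horArrow_mirror {i j : Fin n} : R.mirror.HorArrow i j ↔ R.VertArrow i.rev j.rev := by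
  refine and_congr Fin.rev_lt_rev.symm (exists₃_congr fun x y₁ y₂ => ?_)
  refine and_congr Iff.rfl (and_congr Iff.rfl (and_congr Rect.mem_mirror (and_congr Rect.mem_mirror
    ⟨fun h k hi hj y hy hm => ?_, fun h k hi hj y hy hm => ?_⟩)))
  · refine h k.rev (fun h' => hi (by rw [← h', Fin.rev_rev]))
      (fun h' => hj (by rw [← h', Fin.rev_rev])) y hy (Rect.mem_mirror.2 ?_)
    simpa using hm
  · exact h k.rev (Fin.rev_injective.ne hi) (Fin.rev_injective.ne hj) y hy (Rect.mem_mirror.1 hm)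

theorem mem_VP_mirror {P : Fin n → ℝ × ℝ} {i j : Fin n} :
    j ∈ R.mirror.VP (mirrorPts P) i ↔ j.rev ∈ R.HP P i.rev := by
  have hr : j = i ↔ j.rev = i.rev := Fin.rev_injective.eq_iff.symm
  refine or_congr hr (and_congr (or_congr hr vertArrow_mirror) ⟨?_, ?_⟩)
  · rintro ⟨l, hl, hle⟩
    exact ⟨l.rev, Fin.rev_le_rev.2 hl, Prod.swap_le_swap.1 hle⟩
  · rintro ⟨l, hl, hle⟩
    refine ⟨l.rev, by rwa [← Fin.rev_le_rev, Fin.rev_rev], ?_⟩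
    change _ ≤ (P l.rev.rev).swap
    rw [Fin.rev_rev]
    exact Prod.swap_le_swap.2 hle

theorem ncard_VP_mirror {P : Fin n → ℝ × ℝ} {i : Fin n} :
    (R.mirror.VP (mirrorPts P) i).ncard = (R.HP P i.rev).ncard := by
  rw [← Set.ncard_image_of_injective _ Fin.rev_injective]
  congr 1
  ext j
  refine ⟨?_, fun h => ⟨j.rev, mem_VP_mirror.2 (by rwa [Fin.rev_rev]), Fin.rev_rev j⟩⟩
  rintro ⟨k, hk, rfl⟩
  exact mem_VP_mirror.1 hk

variable (R) in
/-- The regions forced by vertical choices: those with a horizontal arrow which neither reaches nor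
passes an earlier region of `S`, and those with a vertical arrow which reaches or passes a later
one. -/
def HorForced (S : Finset (Fin n)) (i : Fin n) : Prop :=
  i ∈ S ∧ ((∃ j, R.HorArrow i j ∧ ∀ s ∈ S, s < i → s < j) ∨
    ∃ j, R.VertArrow i j ∧ ∃ s ∈ S, s ≤ j ∧ i < s)

theorem hasFamily_hor {P : Fin n → ℝ × ℝ} (hP : R.Respects P) (S : Finset (Fin n))
    (htouch : ∀ i ∈ S, ∀ l, l ≠ i → ¬ (R.region i).tr ≤ P l) :
    R.HasFamily (∏ i ∈ S, (R.HP P i).ncard) {i | R.HorForced S i} := by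
  have hfam := (hasFamily_vert (R := R.mirror) (respects_mirrorPts.2 hP) (S.image Fin.rev)
    fun i hi l hl hle => ?_).of_mirror
  · rw [Finset.prod_image Fin.rev_injective.injOn] at hfam
    simp only [ncard_VP_mirror, Fin.rev_rev] at hfam
    obtain ⟨Q, h1, h2, h3⟩ := hfam
    refine ⟨Q, h1, h2, fun a i hi => h3 a i ?_⟩
    refine ⟨Finset.mem_image_of_mem _ hi.1, hi.2.imp ?_ ?_⟩
    · rintro ⟨j, hj, hs⟩
      refine ⟨j.rev, vertArrow_mirror.2 (by simpa using hj), ?_⟩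
      simpa [Fin.rev_lt_rev] using hs
    · rintro ⟨j, hj, s, hs, hsj, his⟩
      exact ⟨j.rev, horArrow_mirror.2 (by simpa using hj), s.rev,
        Finset.mem_image_of_mem _ hs, Fin.rev_le_rev.2 hsj, Fin.rev_lt_rev.2 his⟩
  · obtain ⟨s, hs, rfl⟩ := Finset.mem_image.1 hi
    refine htouch s hs l.rev (fun h => hl (by rw [← h, Fin.rev_rev])) ?_
    have := Prod.swap_le_swap.1 hle
    rwa [Fin.rev_rev] at this

theorem vertForced_or_horForced {S : Finset (Fin n)} {i : Fin n} (hi : i ∈ S)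
    (h : ¬ R.IsSink i) : R.VertForced S i ∨ R.HorForced S i := by
  unfold IsSink at h
  push Not at h
  obtain ⟨j, hj⟩ := h
  by_cases hv : R.VertArrow i j
  · by_cases hS : ∃ s ∈ S, s ≤ j ∧ i < s
    · exact Or.inr ⟨hi, Or.inr ⟨j, hv, hS⟩⟩
    · exact Or.inl ⟨hi, Or.inl ⟨j, hv, fun s hs his =>
        not_le.1 fun hle => hS ⟨s, hs, hle, his⟩⟩⟩
  · have hh := hj hv
    by_cases hS : ∃ s ∈ S, j ≤ s ∧ s < i
    · exact Or.inl ⟨hi, Or.inr ⟨j, hh, hS⟩⟩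
    · exact Or.inr ⟨hi, Or.inl ⟨j, hh, fun s hs his =>
        not_le.1 fun hle => hS ⟨s, hs, hle, his⟩⟩⟩

end TruncatedSet

/-! ### Lower bounds for the real RAM -/

/-- The comparisons of reals: the only instructions by which the points influence the control flow
and, with it, the word memory. -/
def Instr.IsBranch : Instr → Prop
  | .ifRealZero _ _ => True
  | .ifRealPos _ _ => True
  | _ => False

theorem exec_congr {n : ℕ} {P P' : Fin n → ℝ × ℝ} {I : Instr} (hI : ¬ I.IsBranch) {s s' : Config}
    (hpc : s.pc = s'.pc) (hw : s.word = s'.word) :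
    (exec P I s).pc = (exec P' I s').pc ∧ (exec P I s).word = (exec P' I s').word := by
  cases I <;> simp_all [exec, Instr.IsBranch]

theorem exec_branch {I : Instr} (hI : I.IsBranch) : ∃ l, ∀ {n : ℕ} (P : Fin n → ℝ × ℝ)
    (s : Config), (exec P I s).word = s.word ∧
      ((exec P I s).pc = l ∨ (exec P I s).pc = s.pc + 1) := by
  cases I with
  | ifRealZero a l => exact ⟨l, fun P s => ⟨rfl, ite_eq_or_eq _ _ _⟩⟩
  | ifRealPos a l => exact ⟨l, fun P s => ⟨rfl, ite_eq_or_eq _ _ _⟩⟩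
  | _ => exact hI.elim

namespace Algorithm

variable {n : ℕ} {A : Algorithm n}

theorem HaltsAt.run_eq {P : Fin n → ℝ × ℝ} {t s : ℕ} (h : A.HaltsAt P t) (hts : t ≤ s) :
    A.run P s = A.run P t := by
  induction s, hts using Nat.le_induction with
  | base => rfl
  | succ s _ ih =>
    have h' : A.prog[(A.run P s).pc]? = some Instr.halt := by rw [ih]; exact h
    rw [run, step, h', ← ih]
    rfl

theorem HaltsAt.mono {P : Fin n → ℝ × ℝ} {t s : ℕ} (h : A.HaltsAt P t) (hts : t ≤ s) :
    A.HaltsAt P s := by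
  rw [HaltsAt, instrAt, h.run_eq hts]
  exact h

theorem HaltsAt.run_unique {P : Fin n → ℝ × ℝ} {t s : ℕ} (h : A.HaltsAt P t)
    (h' : A.HaltsAt P s) : A.run P s = A.run P t := by
  rcases le_total t s with hts | hts
  exacts [h.run_eq hts, (h'.run_eq hts).symm]

variable (A) in
/-- The instruction due after `s` steps retrieves the point with index `i`. -/
def RetrievesAt (P : Fin n → ℝ × ℝ) (i : Fin n) (s : ℕ) : Prop :=
  ∃ a b, A.instrAt P s = some (.retrieve a b) ∧ (A.run P s).word b = i

theorem run_update {P : Fin n → ℝ × ℝ} {i : Fin n} (h : ∀ s, ¬ A.RetrievesAt P i s) (z : ℝ × ℝ)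
    (t : ℕ) : A.run (Function.update P i z) t = A.run P t := by
  induction t with
  | zero => rfl
  | succ t ih =>
    rw [run, run, ih, step, step]
    cases hI : A.prog[(A.run P t).pc]? with
    | none => rfl
    | some I =>
      change exec _ I _ = exec _ I _
      cases I with
      | retrieve a b =>
        simp only [exec]
        by_cases hb : (A.run P t).word b < n
        · have hne : (⟨(A.run P t).word b, hb⟩ : Fin n) ≠ i := fun he =>
            h t ⟨a, b, hI, congrArg Fin.val he⟩
          simp only [dif_pos hb, Function.update_of_ne hne]
        · simp only [dif_neg hb]
      | _ => rfl

/-- A correct algorithm retrieves every undetermined point. -/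
theorem exists_retrievesAt {R : TruncatedSet n} (hA : A.Solves R) {P : Fin n → ℝ × ℝ} {i : Fin n}
    (h : R.Undetermined P i) : ∃ s, A.RetrievesAt P i s := by
  by_contra hn
  obtain ⟨a, b, k, ha, hb, hka, hkb⟩ := h
  have hrun := run_update (not_exists.1 hn)
  obtain ⟨t, ht, hl⟩ := hA _ ha
  obtain ⟨t', ht', hl'⟩ := hA _ hb
  simp only [HaltsAt, instrAt, hrun] at ht ht' hl hl'
  rw [HaltsAt.run_unique (A := A) (P := P) ht ht'] at hl'
  exact hkb ((hl'.2 k).1 ((hl.2 k).2 hka))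

variable (A) in
open Classical in
/-- The times before `T` at which a comparison of reals is due. -/
noncomputable def branchTimes (P : Fin n → ℝ × ℝ) (T : ℕ) : Finset ℕ :=
  (Finset.range T).filter fun s => ∃ I, A.instrAt P s = some I ∧ I.IsBranch

theorem card_branchTimes_succ (P : Fin n → ℝ × ℝ) (T : ℕ) [Decidable
    (∃ I, A.instrAt P T = some I ∧ I.IsBranch)] : (A.branchTimes P (T + 1)).card =
      (A.branchTimes P T).card + if ∃ I, A.instrAt P T = some I ∧ I.IsBranch then 1 else 0 := by
  unfold branchTimes
  rw [Finset.range_add_one, Finset.filter_insert]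
  split_ifs
  · rw [Finset.card_insert_of_notMem (by simp)]
  · rw [add_zero]

open Classical in
/-- The information-theoretic bound: following the more frequent outcome of each comparison keeps
`N / 2 ^ B` of `N` inputs indistinguishable, where `B` is the number of comparisons made. -/
theorem exists_indistinguishable (A : Algorithm n) {N : ℕ} (Q : Fin N → Fin n → ℝ × ℝ) (T : ℕ) :
    ∃ (F : Finset (Fin N)) (B : ℕ), N ≤ F.card * 2 ^ B ∧
      (∀ a ∈ F, (A.branchTimes (Q a) T).card = B) ∧
      ∀ a ∈ F, ∀ b ∈ F, (A.run (Q a) T).pc = (A.run (Q b) T).pc ∧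
        (A.run (Q a) T).word = (A.run (Q b) T).word := by
  induction T with
  | zero =>
    exact ⟨Finset.univ, 0, by simp, fun _ _ => by simp [branchTimes], fun _ _ _ _ => ⟨rfl, rfl⟩⟩
  | succ T ih =>
    obtain ⟨F, B, hN, hB, hF⟩ := ih
    rcases F.eq_empty_or_nonempty with rfl | ⟨a₀, ha₀⟩
    · exact ⟨∅, 0, by simpa using hN, by simp, by simp⟩
    have hinstr : ∀ a ∈ F, A.instrAt (Q a) T = A.instrAt (Q a₀) T := fun a ha => by
      rw [instrAt, instrAt, (hF a ha a₀ ha₀).1]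
    by_cases hbr : ∃ I, A.instrAt (Q a₀) T = some I ∧ I.IsBranch
    · have hcount : ∀ a ∈ F, (A.branchTimes (Q a) (T + 1)).card = B + 1 := fun a ha => by
        rw [card_branchTimes_succ, if_pos (by rw [hinstr a ha]; exact hbr), hB a ha]
      obtain ⟨I, hI, hIb⟩ := hbr
      obtain ⟨l, hl⟩ := exec_branch hIb
      have hrun : ∀ a ∈ F, A.run (Q a) (T + 1) = exec (Q a) I (A.run (Q a) T) := fun a ha => by
        have := (hinstr a ha).trans hI
        rw [instrAt] at this
        rw [run, step, this]
      have hword : ∀ a ∈ F, ∀ b ∈ F,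
          (A.run (Q a) (T + 1)).word = (A.run (Q b) (T + 1)).word := fun a ha b hb => by
        rw [hrun a ha, hrun b hb, (hl _ _).1, (hl _ _).1, (hF a ha b hb).2]
      set F₁ := F.filter fun a => (A.run (Q a) (T + 1)).pc = l with hF₁
      set F₂ := F.filter fun a => ¬ (A.run (Q a) (T + 1)).pc = l with hF₂
      have hsum : F₁.card + F₂.card = F.card := Finset.card_filter_add_card_filter_not _
      rcases le_total F₁.card F₂.card with h12 | h12
      · refine ⟨F₂, B + 1, ?_, fun a ha => hcount a (Finset.mem_filter.1 ha).1, ?_⟩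
        · calc N ≤ F.card * 2 ^ B := hN
            _ ≤ (F₂.card * 2) * 2 ^ B := Nat.mul_le_mul_right _ (by omega)
            _ = F₂.card * 2 ^ (B + 1) := by ring
        · intro a ha b hb
          obtain ⟨ha, ha'⟩ := Finset.mem_filter.1 ha
          obtain ⟨hb, hb'⟩ := Finset.mem_filter.1 hb
          refine ⟨?_, hword a ha b hb⟩
          rw [hrun a ha] at ha' ⊢
          rw [hrun b hb] at hb' ⊢
          rw [(hl _ _).2.resolve_left ha', (hl _ _).2.resolve_left hb', (hF a ha b hb).1]
      · refine ⟨F₁, B + 1, ?_, fun a ha => hcount a (Finset.mem_filter.1 ha).1, ?_⟩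
        · calc N ≤ F.card * 2 ^ B := hN
            _ ≤ (F₁.card * 2) * 2 ^ B := Nat.mul_le_mul_right _ (by omega)
            _ = F₁.card * 2 ^ (B + 1) := by ring
        · intro a ha b hb
          obtain ⟨ha, ha'⟩ := Finset.mem_filter.1 ha
          obtain ⟨hb, hb'⟩ := Finset.mem_filter.1 hb
          exact ⟨ha'.trans hb'.symm, hword a ha b hb⟩
    · refine ⟨F, B, hN, fun a ha => ?_, fun a ha b hb => ?_⟩
      · rw [card_branchTimes_succ, if_neg (by rw [hinstr a ha]; exact hbr), hB a ha, add_zero]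
      · have h := hF a ha b hb
        have ha' := hinstr a ha
        have hb' := hinstr b hb
        rw [run, run, step, step]
        cases hI : A.instrAt (Q a₀) T with
        | none =>
          rw [hI, instrAt] at ha' hb'
          rw [ha', hb']
          exact h
        | some I =>
          rw [hI, instrAt] at ha' hb'
          rw [ha', hb']
          exact exec_congr (fun hIb => hbr ⟨I, hI, hIb⟩) h.1 h.2

open Classical in
/-- Retrievals of different points, comparisons and the final halt are different steps. -/
theorem le_costUpTo (C : ℝ≥0) {P : Fin n → ℝ × ℝ} {t : ℕ} (ht : A.HaltsAt P t)
    {K : Set (Fin n)} (hK : ∀ i ∈ K, ∃ s, A.RetrievesAt P i s) (T : ℕ) :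
    (C : ℝ≥0∞) * K.ncard + (A.branchTimes P T).card + 1 ≤ A.costUpTo C P t := by
  have hlt : ∀ {s I}, A.instrAt P s = some I → I ≠ .halt → s < t := by
    intro s I hI hne
    by_contra h
    exact hne (Option.some.inj (hI.symm.trans (ht.mono (not_lt.1 h))))
  choose! τ hτ using hK
  have hinj : Set.InjOn τ K := by
    intro i hi j hj hij
    obtain ⟨a, b, h1, h2⟩ := hτ i hi
    obtain ⟨a', b', h1', h2'⟩ := hτ j hj
    rw [← hij] at h1' h2'
    cases h1.symm.trans h1'
    exact Fin.ext (h2.symm.trans h2')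
  set F : Finset ℕ := K.toFinset.image τ with hF
  have hFcard : F.card = K.ncard := by
    rw [hF, Finset.card_image_of_injOn (by simpa using hinj), Set.ncard_eq_toFinset_card']
  have hFinstr : ∀ s ∈ F, ∃ a b, A.instrAt P s = some (.retrieve a b) := by
    intro s hs
    obtain ⟨i, hi, rfl⟩ := Finset.mem_image.1 hs
    obtain ⟨a, b, h, -⟩ := hτ i (Set.mem_toFinset.1 hi)
    exact ⟨a, b, h⟩
  have hdisj : Disjoint F (A.branchTimes P T) := by
    rw [Finset.disjoint_left]
    intro s hs hs'
    obtain ⟨a, b, h⟩ := hFinstr s hs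
    obtain ⟨-, I, hI, hIb⟩ := Finset.mem_filter.1 hs'
    cases h.symm.trans hI
    exact hIb
  have hsub : F ∪ A.branchTimes P T ⊆ Finset.range t := by
    intro s hs
    rw [Finset.mem_range]
    rcases Finset.mem_union.1 hs with hs | hs
    · obtain ⟨a, b, h⟩ := hFinstr s hs
      exact hlt h (by simp)
    · obtain ⟨-, I, hI, hIb⟩ := Finset.mem_filter.1 hs
      refine hlt hI ?_
      rintro rfl
      exact hIb
  have hht : (A.instrAt P t).elim 0 (Instr.cost C) = 1 := by
    rw [show A.instrAt P t = some .halt from ht]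
    rfl
  have h1 : ∑ s ∈ F, (A.instrAt P s).elim 0 (Instr.cost C) = (C : ℝ≥0∞) * K.ncard := by
    rw [Finset.sum_congr rfl (g := fun _ => (C : ℝ≥0∞)), Finset.sum_const, hFcard, nsmul_eq_mul,
      mul_comm]
    intro s hs
    obtain ⟨a, b, h⟩ := hFinstr s hs
    rw [h]
    rfl
  have h2 : ∑ s ∈ A.branchTimes P T, (A.instrAt P s).elim 0 (Instr.cost C) =
      (A.branchTimes P T).card := by
    rw [Finset.sum_congr rfl (g := fun _ => (1 : ℝ≥0∞)), Finset.sum_const, nsmul_one]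
    intro s hs
    obtain ⟨-, I, hI, hIb⟩ := Finset.mem_filter.1 hs
    rw [hI]
    cases I with
    | ifRealZero => rfl
    | ifRealPos => rfl
    | _ => exact hIb.elim
  rw [costUpTo, Finset.sum_range_succ, hht, ← h1, ← h2, ← Finset.sum_union hdisj]
  exact add_le_add_left (Finset.sum_le_sum_of_subset hsub) 1

end Algorithm

open Classical in
/-- On some member of a family of `N` point sets, an algorithm makes `log₂ N` comparisons to tell
them apart, retrieves all undetermined points and halts. -/
theorem TruncatedSet.HasFamily.le_lowerBound {n : ℕ} {R : TruncatedSet n} {N : ℕ} {K : Set (Fin n)}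
    (h : R.HasFamily N K) (hN : 0 < N) (C : ℝ≥0) :
    ENNReal.ofReal (C * K.ncard + Real.logb 2 N + 1) ≤ uncertaintyRegionLowerBound C R := by
  obtain ⟨Q, hQ, hinj, hund⟩ := h
  refine le_iInf₂ fun A hA => ?_
  choose t ht hl using fun a => hA (Q a) (hQ a)
  obtain ⟨F, B, hNF, hB, hF⟩ := A.exists_indistinguishable Q (Finset.univ.sup t)
  have hrun : ∀ a, A.run (Q a) (Finset.univ.sup t) = A.run (Q a) (t a) := fun a =>
    (ht a).run_eq (Finset.le_sup (Finset.mem_univ a))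
  -- Indistinguishable inputs lead to the same output, so only one of them is left.
  have hF1 : F.card ≤ 1 := by
    refine Finset.card_le_one.2 fun a ha b hb => hinj a b fun k => ?_
    have hab := hF a ha b hb
    rw [hrun, hrun] at hab
    have h1 := hl a
    rw [hab.1, hab.2] at h1
    exact (h1.2 k).symm.trans ((hl b).2 k)
  have hFne : F.Nonempty := by
    rw [← Finset.card_pos]
    by_contra h0
    rw [Nat.eq_zero_of_not_pos h0, zero_mul] at hNF
    exact absurd hNF (not_le.2 hN)
  obtain ⟨a, ha⟩ := hFne
  have hNB : N ≤ 2 ^ B := hNF.trans (by simpa using Nat.mul_le_mul_right (2 ^ B) hF1)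
  have hlog : Real.logb 2 N ≤ B := by
    rw [Real.logb_le_iff_le_rpow one_lt_two (by exact_mod_cast hN), Real.rpow_natCast]
    exact_mod_cast hNB
  calc ENNReal.ofReal (C * K.ncard + Real.logb 2 N + 1)
      ≤ ENNReal.ofReal (C * K.ncard + B + 1) := ENNReal.ofReal_le_ofReal (by linarith)
    _ = (C : ℝ≥0∞) * K.ncard + B + 1 := by
        rw [ENNReal.ofReal_add (by positivity) zero_le_one, ENNReal.ofReal_add (by positivity)
          (by positivity), ENNReal.ofReal_mul C.coe_nonneg]
        simp
    _ ≤ A.runtime C (Q a) := le_iInf₂ fun s hs => by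
        rw [← hB a ha]
        exact A.le_costUpTo C hs (fun i hi => A.exists_retrievesAt hA (hund a i hi)) _
    _ ≤ _ := le_iSup₂_of_le (Q a) (hQ a) le_rfl

/-! ### Counting fronts -/

theorem exists_isFrontSeq {n : ℕ} {P : Fin n → ℝ × ℝ} (h : Function.Injective fun i => (P i).1) :
    ∃ l, IsFrontSeq P l := by
  classical
  set l := ((List.finRange n).filter fun i => OnFront P i).insertionSort
    fun i j => (P i).1 ≤ (P j).1 with hl
  have hperm : l.Perm ((List.finRange n).filter fun i => OnFront P i) := List.perm_insertionSort _ _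
  have hnd : l.Nodup := hperm.nodup_iff.2 ((List.nodup_finRange n).filter _)
  have : Std.Total fun i j : Fin n => (P i).1 ≤ (P j).1 := ⟨fun _ _ => le_total _ _⟩
  have : IsTrans (Fin n) fun i j => (P i).1 ≤ (P j).1 := ⟨fun _ _ _ => le_trans⟩
  refine ⟨l, ?_, fun i => by rw [hperm.mem_iff]; simp⟩
  have hs : l.Pairwise fun i j => (P i).1 ≤ (P j).1 := List.pairwise_insertionSort _ _
  exact (hs.and hnd).imp fun {a b} hab => lt_of_le_of_ne hab.1 (h.ne hab.2)

theorem TruncatedSet.HasFamily.le_numFronts {n : ℕ} {R : TruncatedSet n} {N : ℕ}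
    {K : Set (Fin n)} (h : R.HasFamily N K) : N ≤ R.numFronts := by
  obtain ⟨Q, hQ, hinj, -⟩ := h
  choose l hl using fun a => exists_isFrontSeq (hQ a).fst_injective
  have hlinj : Function.Injective l := by
    intro a b hab
    refine hinj a b fun k => ?_
    rw [← (hl a).2, ← (hl b).2, hab]
  have hfin : {l : List (Fin n) | ∃ P, R.Respects P ∧ IsFrontSeq P l}.Finite := by
    refine (List.finite_length_le (Fin n) n).subset ?_
    rintro l ⟨P, -, hl⟩
    have hnd : l.Nodup := hl.1.imp fun {a b} hab he => hab.ne (by rw [he])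
    simpa using hnd.length_le_card
  calc N = (Set.range l).ncard := by
        rw [← Set.image_univ, Set.ncard_image_of_injective _ hlinj, Set.ncard_univ, Nat.card_fin]
    _ ≤ R.numFronts := by
        refine Set.ncard_le_ncard ?_ hfin
        rintro _ ⟨a, rfl⟩
        exact ⟨Q a, hQ a, hl a⟩

/-! ### Comparison of the cost function with the lower bound -/

namespace TruncatedSet

variable {n : ℕ} {R : TruncatedSet n} {P : Fin n → ℝ × ℝ}

theorem ncard_VP_pos (i : Fin n) : 0 < (R.VP P i).ncard :=
  (Set.ncard_pos (Set.toFinite _)).2 ⟨i, Or.inl rfl⟩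

theorem ncard_HP_pos (i : Fin n) : 0 < (R.HP P i).ncard :=
  (Set.ncard_pos (Set.toFinite _)).2 ⟨i, Or.inl rfl⟩

theorem logb_prod_cast (S : Finset (Fin n)) {c : Fin n → ℕ} (hc : ∀ i, 0 < c i) :
    Real.logb 2 ((∏ i ∈ S, c i : ℕ) : ℝ) = ∑ i ∈ S, Real.logb 2 (c i : ℝ) := by
  rw [Nat.cast_prod, Real.logb_prod]
  exact fun i _ => Nat.cast_ne_zero.2 (hc i).ne'

theorem interesting_iff {i : Fin n} : i ∈ R.interesting P ↔ R.Interesting P i := by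
  simp [interesting]

theorem not_tr_le_of_interesting (hP : R.Respects P) {i : Fin n} (hi : i ∈ R.interesting P)
    (l : Fin n) (hl : l ≠ i) : ¬ (R.region i).tr ≤ P l :=
  R.not_tr_le_of_meets_front hP (interesting_iff.1 hi).1 hl

/-- Every interesting region is forced on `P`, or by all horizontal choices, or by all vertical
choices. -/
theorem card_interesting_le (hP : R.Respects P) : (R.interesting P).card ≤
    {i | R.VertForced (R.interesting P) i}.ncard + {i | R.HorForced (R.interesting P) i}.ncard +
      {i | i ∈ R.interesting P ∧ R.Undetermined P i}.ncard := by
  rw [← Set.ncard_coe_finset]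
  refine (Set.ncard_le_ncard ?_ (Set.toFinite _)).trans ((Set.ncard_union_le
    ({i | R.VertForced (R.interesting P) i} ∪ {i | R.HorForced (R.interesting P) i})
    {i | i ∈ R.interesting P ∧ R.Undetermined P i}).trans
      (Nat.add_le_add_right (Set.ncard_union_le _ _) _))
  intro i hi
  have hi' : i ∈ R.interesting P := hi
  have hund := undetermined_of_flagged_or_edge hP (not_tr_le_of_interesting hP hi')
  rcases (interesting_iff.1 hi').2 with h | h | h
  · exact Or.inr ⟨hi', hund (Or.inl h)⟩
  · exact Or.inr ⟨hi', hund (Or.inr h)⟩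
  · exact Or.inl (vertForced_or_horForced hi' h)

end TruncatedSet

end ParetoPre

open ParetoPre ParetoPre.TruncatedSet in
theorem mainTheorem3 (C : ℝ≥0) (n : ℕ) (R : ParetoPre.TruncatedSet n)
    (P : Fin n → ℝ × ℝ) (hP : R.Respects P) :
    ENNReal.ofReal (R.paretoCost C P) < 3 * ParetoPre.uncertaintyRegionLowerBound C R ∧
    ∑ i ∈ R.interesting P,
        (Real.logb 2 ((R.VP P i).ncard : ℝ) + Real.logb 2 ((R.HP P i).ncard : ℝ)) ≤
      2 * Real.logb 2 (R.numFronts : ℝ) := by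
  have htouch := fun i (hi : i ∈ R.interesting P) => not_tr_le_of_interesting hP hi
  have hV := hasFamily_vert hP (R.interesting P) htouch
  have hH := hasFamily_hor hP (R.interesting P) htouch
  have hU := hasFamily_one hP (K := {i | i ∈ R.interesting P ∧ R.Undetermined P i})
    fun i hi => hi.2
  have hVpos : 0 < ∏ i ∈ R.interesting P, (R.VP P i).ncard :=
    Finset.prod_pos fun i _ => ncard_VP_pos i
  have hHpos : 0 < ∏ i ∈ R.interesting P, (R.HP P i).ncard :=
    Finset.prod_pos fun i _ => ncard_HP_pos i
  have hVlog := logb_prod_cast (R.interesting P) (ncard_VP_pos (R := R) (P := P))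
  have hHlog := logb_prod_cast (R.interesting P) (ncard_HP_pos (R := R) (P := P))
  constructor
  · have bV := hV.le_lowerBound hVpos C
    have bH := hH.le_lowerBound hHpos C
    have bU := hU.le_lowerBound one_pos C
    rw [hVlog] at bV
    rw [hHlog] at bH
    rw [Nat.cast_one, Real.logb_one, add_zero] at bU
    have hV0 : 0 ≤ ∑ i ∈ R.interesting P, Real.logb 2 ((R.VP P i).ncard : ℝ) := by
      rw [← hVlog]
      exact Real.logb_nonneg one_lt_two (by exact_mod_cast hVpos)
    have hH0 : 0 ≤ ∑ i ∈ R.interesting P, Real.logb 2 ((R.HP P i).ncard : ℝ) := by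
      rw [← hHlog]
      exact Real.logb_nonneg one_lt_two (by exact_mod_cast hHpos)
    have hcost : R.paretoCost C P = C * (R.interesting P).card +
        ∑ i ∈ R.interesting P, Real.logb 2 ((R.VP P i).ncard : ℝ) +
        ∑ i ∈ R.interesting P, Real.logb 2 ((R.HP P i).ncard : ℝ) := by
      rw [paretoCost, Finset.sum_add_distrib, Finset.sum_add_distrib, Finset.sum_const,
        nsmul_eq_mul, mul_comm]
    have hcard := mul_le_mul_of_nonneg_left
      (show ((R.interesting P).card : ℝ) ≤ _ from Nat.cast_le.2 (card_interesting_le hP))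
      C.coe_nonneg
    push_cast at hcard
    refine lt_of_lt_of_le ?_ ((add_le_add (add_le_add bV bH) bU).trans_eq (by ring))
    have hC := C.coe_nonneg
    refine lt_of_lt_of_le ?_ (ENNReal.ofReal_add_le.trans (add_le_add ENNReal.ofReal_add_le le_rfl))
    refine (ENNReal.ofReal_lt_ofReal_iff ?_).2 ?_
    · positivity
    · linarith
  · have hlog : ∀ {N : ℕ}, 0 < N → N ≤ R.numFronts →
        Real.logb 2 N ≤ Real.logb 2 (R.numFronts : ℝ) := fun h0 h =>
      Real.logb_le_logb_of_le one_lt_two (by exact_mod_cast h0) (by exact_mod_cast h)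
    rw [Finset.sum_add_distrib, ← hVlog, ← hHlog]
    linarith [hlog hVpos hV.le_numFronts, hlog hHpos hH.le_numFronts]
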